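/- Let $\ell>0$ and let $\rho,\sigma\in H^2(0,\ell)$ and $q\in H^1(0,\ell)$ be real-valued, with constants $\rho_0,\sigma_0>0$ such that $\rho(x)\ge\rho_0$, $\sigma(x)\ge\sigma_0$ and $q(x)\ge 0$ for all $x\in[0,\ell]$. Consider the spectral problem $$(\sigma\phi'')''-(q\phi')'=\lambda\rho\,\phi\ \text{ on }(0,\ell),\qquad \phi(0)=\phi'(0)=\phi(\ell)=\phi'(\ell)=0,$$ for complex-valued $\phi\in H^4(0,\ell)$ and $\lambda\in\mathbb C$; equivalently, the eigenvalue problem $\mathcal A\phi=\lambda\phi$ for the operator $\mathcal A y=\rho^{-1}\big((\sigma y'')''-(qy')'\big)$ in $L^2_\rho(0,\ell)=L^2((0,\ell),\rho\,dx)$ with domain $H^4(0,\ell)\cap H^2_0(0,\ell)$. Then all eigenvalues are real and simple, geometrically and algebraically (that is, $\dim\ker(\mathcal A-\lambda)=\dim\bigcup_{k\ge1}\ker(\mathcal A-\lambda)^k=1$ for each eigenvalue $\lambda$), and the set of all eigenvalues is a sequence $$0<\lambda_1<\lambda_2<\dots<\lambda_n<\dots\xrightarrow[n\to\infty]{}+\infty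 .$$ Moreover, for every $n\ge1$, every eigenfunction $\Phi_n$ associated with $\lambda_n$ satisfies $\Phi_n''(\ell)\neq0$. -/

import Mathlib

open MeasureTheory Set

noncomputable section

namespace ClampedBeam

/-- `g` is the weak derivative of `f` on `(0,ℓ)`, both being in `L²(0,ℓ)`:
`∫ φ' f = - ∫ φ g` for all smooth test functions `φ` with compact support in `(0,ℓ)`. -/
structure HasWeakDeriv {E : Type*} [NormedAddCommGroup E] [NormedSpace ℝ E]
    (ℓ : ℝ) (f g : ℝ → E) : Prop where
  memLp_fun : MemLp f 2 (volume.restrict (Ioo 0 ℓ))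
  memLp_deriv : MemLp g 2 (volume.restrict (Ioo 0 ℓ))
  integral_eq : ∀ φ : ℝ → ℝ, ContDiff ℝ (⊤ : ℕ∞) φ → HasCompactSupport φ →
    tsupport φ ⊆ Ioo 0 ℓ →
    ∫ x in Ioo 0 ℓ, deriv φ x • f x = - ∫ x in Ioo 0 ℓ, φ x • g x

/-- Membership in the Sobolev space `H^k(0,ℓ)`. -/
def MemH {E : Type*} [NormedAddCommGroup E] [NormedSpace ℝ E] (ℓ : ℝ) :
    ℕ → (ℝ → E) → Prop
  | 0, f => MemLp f 2 (volume.restrict (Ioo 0 ℓ))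
  | k + 1, f => ∃ g, HasWeakDeriv ℓ f g ∧ MemH ℓ k g

/-- `u ∈ H⁴(0,ℓ) ∩ H²₀(0,ℓ)`, given by its `C³([0,ℓ])` representative. -/
structure MemDomain (ℓ : ℝ) (u : ℝ → ℂ) : Prop where
  memH : MemH ℓ 4 u
  contDiffOn : ContDiffOn ℝ 3 u (Icc 0 ℓ)
  left : u 0 = 0
  deriv_left : derivWithin u (Icc 0 ℓ) 0 = 0
  right : u ℓ = 0
  deriv_right : derivWithin u (Icc 0 ℓ) ℓ = 0

/-- `u ∈ H⁴(0,ℓ) ∩ H²₀(0,ℓ)` and `(σ u'')'' - (q u')' = g` almost everywhere on `(0,ℓ)`. Here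
`m₁ = (σ u'')'`, `m₂ = (σ u'')''` and `p₁ = (q u')'` are weak derivatives. -/
def SolvesClamped (ℓ : ℝ) (σ q : ℝ → ℝ) (u g : ℝ → ℂ) : Prop :=
  MemDomain ℓ u ∧
  ∃ m₁ m₂ p₁ : ℝ → ℂ,
    HasWeakDeriv ℓ (fun x => σ x • iteratedDerivWithin 2 u (Icc 0 ℓ) x) m₁ ∧
    HasWeakDeriv ℓ m₁ m₂ ∧
    HasWeakDeriv ℓ (fun x => q x • derivWithin u (Icc 0 ℓ) x) p₁ ∧
    ∀ᵐ x ∂volume.restrict (Ioo 0 ℓ), m₂ x - p₁ x = g x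

/-- `Φ` is an eigenfunction, for the parameter `z`, of the problem
`(σ φ'')'' - (q φ')' = z ρ φ`, `φ(0) = φ'(0) = φ(ℓ) = φ'(ℓ) = 0`. -/
def IsEigenfunction (ℓ : ℝ) (σ q ρ : ℝ → ℝ) (z : ℂ) (Φ : ℝ → ℂ) : Prop :=
  SolvesClamped ℓ σ q Φ (fun x => z * (ρ x : ℂ) * Φ x) ∧ ∃ x ∈ Icc 0 ℓ, Φ x ≠ 0

/-- `z` is an eigenvalue of the clamped problem. -/
def IsEigenvalue (ℓ : ℝ) (σ q ρ : ℝ → ℝ) (z : ℂ) : Prop :=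
  ∃ Φ : ℝ → ℂ, IsEigenfunction ℓ σ q ρ z Φ

/-- The measure `ρ(x) dx` on `(0,ℓ)`. -/
def weight (ℓ : ℝ) (ρ : ℝ → ℝ) : Measure ℝ :=
  (volume.restrict (Ioo 0 ℓ)).withDensity (fun x => ENNReal.ofReal (ρ x))

/-- The space `L²_ρ(0,ℓ)` of complex functions. -/
abbrev L2w (ℓ : ℝ) (ρ : ℝ → ℝ) : Type := Lp ℂ 2 (weight ℓ ρ)

section Closure

variable {E : Type*} [NormedAddCommGroup E] [NormedSpace ℝ E] {ℓ : ℝ}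

lemma integrable_smul_of_memLp {φ : ℝ → ℝ} (hφ : Continuous φ) (hc : HasCompactSupport φ)
    {f : ℝ → E} (hf : MemLp f 2 (volume.restrict (Ioo 0 ℓ))) :
    Integrable (fun x => φ x • f x) (volume.restrict (Ioo 0 ℓ)) := by
  have h1 : Integrable f (volume.restrict (Ioo 0 ℓ)) := hf.integrable (by norm_num)
  obtain ⟨C, hC⟩ := hc.exists_bound_of_continuous hφ
  exact h1.bdd_smul C hφ.aestronglyMeasurable (Filter.Eventually.of_forall hC)

lemma HasWeakDeriv.add {f g f' g' : ℝ → E} (h : HasWeakDeriv ℓ f g)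
    (h' : HasWeakDeriv ℓ f' g') : HasWeakDeriv ℓ (f + f') (g + g') := by
  refine ⟨h.1.add h'.1, h.2.add h'.2, fun φ hφ hc hs => ?_⟩
  have hd : Continuous (deriv φ) := hφ.continuous_deriv (by simp)
  simp only [Pi.add_apply, smul_add]
  rw [integral_add (integrable_smul_of_memLp hd hc.deriv h.1)
      (integrable_smul_of_memLp hd hc.deriv h'.1),
    integral_add (integrable_smul_of_memLp hφ.continuous hc h.2)
      (integrable_smul_of_memLp hφ.continuous hc h'.2),
    h.3 φ hφ hc hs, h'.3 φ hφ hc hs, neg_add]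

lemma HasWeakDeriv.const_smul {f g : ℝ → ℂ} (h : HasWeakDeriv ℓ f g) (c : ℂ) :
    HasWeakDeriv ℓ (c • f) (c • g) := by
  refine ⟨h.1.const_smul c, h.2.const_smul c, fun φ hφ hc hs => ?_⟩
  simp only [Pi.smul_apply, smul_comm _ c]
  rw [integral_smul, integral_smul, h.3 φ hφ hc hs, smul_neg]

lemma HasWeakDeriv.congr {f g f' : ℝ → E} (h : HasWeakDeriv ℓ f g)
    (hf : EqOn f' f (Ioo 0 ℓ)) : HasWeakDeriv ℓ f' g := by
  refine ⟨h.1.ae_eq ?_, h.2, fun φ hφ hc hs => ?_⟩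
  · exact (ae_restrict_of_forall_mem measurableSet_Ioo fun x hx => (hf hx).symm)
  · rw [← h.3 φ hφ hc hs]
    exact setIntegral_congr_fun measurableSet_Ioo fun x hx => by simp only [hf hx]

lemma MemH.add : ∀ {k : ℕ} {f g : ℝ → E}, MemH ℓ k f → MemH ℓ k g → MemH ℓ k (f + g)
  | 0, _, _, hf, hg => MemLp.add hf hg
  | _ + 1, _, _, ⟨f', hf, hf'⟩, ⟨g', hg, hg'⟩ => ⟨f' + g', hf.add hg, MemH.add hf' hg'⟩

lemma MemH.const_smul (c : ℂ) : ∀ {k : ℕ} {f : ℝ → ℂ}, MemH ℓ k f → MemH ℓ k (c • f)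
  | 0, _, hf => MemLp.const_smul hf c
  | _ + 1, _, ⟨f', hf, hf'⟩ => ⟨c • f', hf.const_smul c, MemH.const_smul c hf'⟩

lemma MemDomain.differentiableWithinAt {u : ℝ → ℂ} (h : MemDomain ℓ u) {x : ℝ}
    (hx : x ∈ Icc 0 ℓ) : DifferentiableWithinAt ℝ u (Icc 0 ℓ) x :=
  h.contDiffOn.differentiableOn (by norm_num) x hx

lemma MemDomain.contDiffWithinAt {u : ℝ → ℂ} (h : MemDomain ℓ u) {x : ℝ}
    (hx : x ∈ Icc 0 ℓ) : ContDiffWithinAt ℝ (2 : ℕ) u (Icc 0 ℓ) x :=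
  (h.contDiffOn x hx).of_le (by norm_num)

lemma MemDomain.add (hℓ : 0 < ℓ) {u v : ℝ → ℂ} (hu : MemDomain ℓ u) (hv : MemDomain ℓ v) :
    MemDomain ℓ (u + v) := by
  have h0 : (0 : ℝ) ∈ Icc 0 ℓ := ⟨le_rfl, hℓ.le⟩
  have h1 : ℓ ∈ Icc 0 ℓ := ⟨hℓ.le, le_rfl⟩
  refine ⟨hu.1.add hv.1, hu.2.add hv.2, ?_, ?_, ?_, ?_⟩
  · simp [hu.left, hv.left]
  · rw [derivWithin_add (hu.differentiableWithinAt h0) (hv.differentiableWithinAt h0),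
      hu.deriv_left, hv.deriv_left, add_zero]
  · simp [hu.right, hv.right]
  · rw [derivWithin_add (hu.differentiableWithinAt h1) (hv.differentiableWithinAt h1),
      hu.deriv_right, hv.deriv_right, add_zero]

lemma MemDomain.const_smul (hℓ : 0 < ℓ) {u : ℝ → ℂ} (hu : MemDomain ℓ u) (c : ℂ) :
    MemDomain ℓ (c • u) := by
  have h0 : (0 : ℝ) ∈ Icc 0 ℓ := ⟨le_rfl, hℓ.le⟩
  have h1 : ℓ ∈ Icc 0 ℓ := ⟨hℓ.le, le_rfl⟩
  refine ⟨hu.1.const_smul c, hu.2.const_smul c, ?_, ?_, ?_, ?_⟩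
  · simp [hu.left]
  · rw [derivWithin_const_smul c (hu.differentiableWithinAt h0), hu.deriv_left, smul_zero]
  · simp [hu.right]
  · rw [derivWithin_const_smul c (hu.differentiableWithinAt h1), hu.deriv_right, smul_zero]

lemma SolvesClamped.add (hℓ : 0 < ℓ) {σ q : ℝ → ℝ} {u v g h : ℝ → ℂ}
    (hu : SolvesClamped ℓ σ q u g) (hv : SolvesClamped ℓ σ q v h) :
    SolvesClamped ℓ σ q (u + v) (g + h) := by
  obtain ⟨du, m₁, m₂, p₁, hm₁, hm₂, hp₁, e⟩ := hu
  obtain ⟨dv, m₁', m₂', p₁', hm₁', hm₂', hp₁', e'⟩ := hv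
  refine ⟨du.add hℓ dv, m₁ + m₁', m₂ + m₂', p₁ + p₁', (hm₁.add hm₁').congr ?_, hm₂.add hm₂',
    (hp₁.add hp₁').congr ?_, ?_⟩
  · intro x hx
    have hx' := Ioo_subset_Icc_self hx
    simp only [Pi.add_apply]
    rw [iteratedDerivWithin_add hx' (uniqueDiffOn_Icc hℓ) (du.contDiffWithinAt hx')
      (dv.contDiffWithinAt hx'), smul_add]
  · intro x hx
    have hx' := Ioo_subset_Icc_self hx
    simp only [Pi.add_apply]
    rw [derivWithin_add (du.differentiableWithinAt hx') (dv.differentiableWithinAt hx'), smul_add]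
  · filter_upwards [e, e'] with x hx hx'
    simp only [Pi.add_apply, ← hx, ← hx']
    ring

lemma SolvesClamped.const_smul (hℓ : 0 < ℓ) {σ q : ℝ → ℝ} {u g : ℝ → ℂ}
    (hu : SolvesClamped ℓ σ q u g) (c : ℂ) : SolvesClamped ℓ σ q (c • u) (c • g) := by
  obtain ⟨du, m₁, m₂, p₁, hm₁, hm₂, hp₁, e⟩ := hu
  refine ⟨du.const_smul hℓ c, c • m₁, c • m₂, c • p₁, (hm₁.const_smul c).congr ?_,
    hm₂.const_smul c, (hp₁.const_smul c).congr ?_, ?_⟩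
  · intro x hx
    have hx' := Ioo_subset_Icc_self hx
    simp only [Pi.smul_apply]
    rw [iteratedDerivWithin_const_smul hx' (uniqueDiffOn_Icc hℓ) c (du.contDiffWithinAt hx'),
      smul_comm]
  · intro x hx
    have hx' := Ioo_subset_Icc_self hx
    simp only [Pi.smul_apply]
    rw [derivWithin_const_smul c (du.differentiableWithinAt hx'), smul_comm]
  · filter_upwards [e] with x hx
    simp only [Pi.smul_apply, ← hx, smul_sub]

lemma hasWeakDeriv_zero : HasWeakDeriv ℓ (0 : ℝ → E) 0 :=
  ⟨MemLp.zero, MemLp.zero, fun φ _ _ _ => by simp⟩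

lemma memH_zero : ∀ k : ℕ, MemH ℓ k (0 : ℝ → E)
  | 0 => MemLp.zero
  | k + 1 => ⟨0, hasWeakDeriv_zero, memH_zero k⟩

lemma solvesClamped_zero (σ q : ℝ → ℝ) : SolvesClamped ℓ σ q 0 0 := by
  refine ⟨⟨memH_zero 4, contDiffOn_const, rfl, ?_, rfl, ?_⟩, 0, 0, 0, ?_, hasWeakDeriv_zero,
    ?_, ?_⟩
  · exact congrFun (derivWithin_const (Icc 0 ℓ) (0 : ℂ)) 0
  · exact congrFun (derivWithin_const (Icc 0 ℓ) (0 : ℂ)) ℓ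
  · refine hasWeakDeriv_zero.congr fun x _ => ?_
    have : iteratedDerivWithin 2 (0 : ℝ → ℂ) (Icc 0 ℓ) x = 0 := by
      exact (iteratedDerivWithin_const (n := 2) (s := Icc 0 ℓ) (c := (0 : ℂ)) (x := x)).trans
        (if_neg two_ne_zero)
    simp [this]
  · refine hasWeakDeriv_zero.congr fun x _ => ?_
    have : derivWithin (0 : ℝ → ℂ) (Icc 0 ℓ) x = 0 :=
      congrFun (derivWithin_const (Icc 0 ℓ) (0 : ℂ)) x
    simp [this]
  · simp

end Closure

/-- The graph of the unbounded operator `𝒜 y = ρ⁻¹ ((σ y'')'' - (q y')')` in `L²_ρ(0,ℓ)` with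
domain `H⁴(0,ℓ) ∩ H²₀(0,ℓ)`: the pairs `(y, f)` with `y` in the domain and
`(σ y'')'' - (q y')' = ρ f`. -/
def opGraph {ℓ : ℝ} (hℓ : 0 < ℓ) (σ q ρ : ℝ → ℝ) : Submodule ℂ (L2w ℓ ρ × L2w ℓ ρ) where
  carrier := {p | ∃ u f : ℝ → ℂ, p.1 =ᵐ[weight ℓ ρ] u ∧ p.2 =ᵐ[weight ℓ ρ] f ∧
    SolvesClamped ℓ σ q u (fun x => (ρ x : ℂ) * f x)}
  add_mem' := by
    rintro p p' ⟨u, f, hu, hf, h⟩ ⟨u', f', hu', hf', h'⟩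
    refine ⟨u + u', f + f', (Lp.coeFn_add _ _).trans (hu.add hu'),
      (Lp.coeFn_add _ _).trans (hf.add hf'), ?_⟩
    convert h.add hℓ h' using 1
    ext x
    simp [mul_add]
  zero_mem' := by
    refine ⟨0, 0, Lp.coeFn_zero _ _ _, Lp.coeFn_zero _ _ _, ?_⟩
    convert solvesClamped_zero σ q using 1
    ext x
    simp
  smul_mem' := by
    rintro c p ⟨u, f, hu, hf, h⟩
    refine ⟨c • u, c • f, (Lp.coeFn_smul _ _).trans (hu.const_smul c),
      (Lp.coeFn_smul _ _).trans (hf.const_smul c), ?_⟩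
    convert h.const_smul hℓ c using 1
    ext x
    simp only [Pi.smul_apply, smul_eq_mul]
    ring

/-- `rootSpace hℓ σ q ρ z k` is the kernel of `(𝒜 - z)^k`: a vector `y` belongs to the kernel of
`(𝒜 - z)^(k+1)` iff it is in the domain of `𝒜` and `w = 𝒜 y - z y` is in that of `(𝒜 - z)^k`. -/
def rootSpace {ℓ : ℝ} (hℓ : 0 < ℓ) (σ q ρ : ℝ → ℝ) (z : ℂ) : ℕ → Submodule ℂ (L2w ℓ ρ)
  | 0 => ⊥
  | k + 1 =>
    { carrier := {y | ∃ w ∈ rootSpace hℓ σ q ρ z k, (y, z • y + w) ∈ opGraph hℓ σ q ρ}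
      add_mem' := by
        rintro y y' ⟨w, hw, h⟩ ⟨w', hw', h'⟩
        refine ⟨w + w', add_mem hw hw', ?_⟩
        convert add_mem h h' using 1
        simp only [Prod.mk_add_mk, smul_add]
        congr 1
        abel
      zero_mem' := ⟨0, zero_mem _, by
        convert zero_mem (opGraph hℓ σ q ρ) using 1
        simp⟩
      smul_mem' := by
        rintro c y ⟨w, hw, h⟩
        refine ⟨c • w, Submodule.smul_mem _ c hw, ?_⟩
        convert Submodule.smul_mem _ c h using 1
        simp only [Prod.smul_mk, smul_add]
        rw [smul_comm] }

/-- The eigenspace `ker (𝒜 - z)`; its dimension is the geometric multiplicity of `z`. -/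
def eigenSpace {ℓ : ℝ} (hℓ : 0 < ℓ) (σ q ρ : ℝ → ℝ) (z : ℂ) : Submodule ℂ (L2w ℓ ρ) :=
  rootSpace hℓ σ q ρ z 1

/-- The root subspace `⋃ₖ ker (𝒜 - z)^k`; its dimension is the algebraic multiplicity of `z`. -/
def genEigenSpace {ℓ : ℝ} (hℓ : 0 < ℓ) (σ q ρ : ℝ → ℝ) (z : ℂ) : Submodule ℂ (L2w ℓ ρ) :=
  ⨆ k, rootSpace hℓ σ q ρ z k

end ClampedBeam

end

/-!
Passing to the continuous representatives `s`, `k`, `p` of `σ`, `q`, `ρ`, the equation becomes a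
first order system for `u`, `u'`, the bending moment `m = s u''` and the shear force
`t = (s u'')' - k u'`. Integration by parts shows that the problem is symmetric with positive
energy `∫ s |u''|² + k |u'|²`, so that eigenvalues are real and positive and there are no Jordan
chains.

For existence, the bending `w = u''` of the solution with load `g` is the solution in the
orthogonal complement of `{1, V†1}`, with `V` the integration operator of `L²(0,ℓ)`, of a coercive
problem (Lax-Milgram); the orthogonality encodes the clamping at `ℓ`. Conjugated with
`√p`, the resulting solution operator is compact, self-adjoint and injective on `L²(0,ℓ)`, and the
spectral theorem gives infinitely many eigenvalues, accumulating only at `+∞`.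

If an eigenfunction had `u''(ℓ) = 0`, then, up to a sign of its real and imaginary parts,
`(u, -u', m, -t)` would start at `ℓ` with nonnegative entries and solve backwards a
linear system with nonnegative matrix. All entries stay nonnegative, so `u` is nonincreasing, and
`u(0) = u(ℓ) = 0` forces `u = 0`. Hence `u''(ℓ)` determines an eigenfunction, and the
eigenvalues are simple.
-/

noncomputable section

namespace ClampedBeam

/-! ### Primitives of square integrable functions -/

section Primitives

variable {E E₂ : Type*} [NormedAddCommGroup E] [NormedAddCommGroup E₂] {ℓ : ℝ}

lemma intervalIntegrable_of_memLp {f : ℝ → E} (hf : MemLp f 2 (volume.restrict (Ioo 0 ℓ)))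
    {x y : ℝ} (hx : x ∈ Icc 0 ℓ) (hy : y ∈ Icc 0 ℓ) : IntervalIntegrable f volume x y := by
  have h : IntegrableOn f (Ioo 0 ℓ) := hf.integrable one_le_two
  have h₀ : IntervalIntegrable f volume 0 ℓ :=
    (intervalIntegrable_iff_integrableOn_Ioo_of_le (hx.1.trans hx.2)).2 h
  exact h₀.mono_set ((uIcc_subset_Icc hx hy).trans Icc_subset_uIcc)

lemma memLp_of_continuousOn {f : ℝ → E} (hf : ContinuousOn f (Icc 0 ℓ)) {p : ENNReal} :
    MemLp f p (volume.restrict (Ioo 0 ℓ)) := by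
  obtain ⟨C, hC⟩ := isCompact_Icc.exists_bound_of_continuousOn hf
  exact .of_bound ((hf.mono Ioo_subset_Icc_self).aestronglyMeasurable measurableSet_Ioo) C
    (ae_restrict_of_forall_mem measurableSet_Ioo fun x hx => hC x (Ioo_subset_Icc_self hx))

lemma eqOn_Icc_of_ae_eq (hℓ : 0 < ℓ) {f g : ℝ → E} (hf : ContinuousOn f (Icc 0 ℓ))
    (hg : ContinuousOn g (Icc 0 ℓ)) (h : f =ᵐ[volume.restrict (Ioo 0 ℓ)] g) :
    EqOn f g (Icc 0 ℓ) := by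
  rw [restrict_Ioo_eq_restrict_Icc] at h
  exact Measure.eqOn_Icc_of_ae_eq volume hℓ.ne h hf hg

lemma le_of_ae_eq_of_continuousOn (hℓ : 0 < ℓ) {f F : ℝ → ℝ} {c : ℝ}
    (hF : ContinuousOn F (Icc 0 ℓ)) (h : f =ᵐ[volume.restrict (Ioo 0 ℓ)] F)
    (hf : ∀ x ∈ Icc 0 ℓ, c ≤ f x) : ∀ x ∈ Icc 0 ℓ, c ≤ F x := by
  have hmax : (fun x => max (F x) c) =ᵐ[volume.restrict (Ioo 0 ℓ)] F := by
    filter_upwards [h, ae_restrict_mem measurableSet_Ioo] with x hx hx'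
    exact max_eq_left (hx ▸ hf x (Ioo_subset_Icc_self hx'))
  exact fun x hx => max_eq_left_iff.1
    (eqOn_Icc_of_ae_eq hℓ (hF.sup continuousOn_const) hF hmax hx)

lemma absolutelyContinuousOnInterval_of_dist_le {X Y : Type*} [PseudoMetricSpace X]
    [PseudoMetricSpace Y] {f : ℝ → X} {g : ℝ → Y} {a b : ℝ}
    (hg : AbsolutelyContinuousOnInterval g a b)
    (h : ∀ x ∈ uIcc a b, ∀ y ∈ uIcc a b, dist (f x) (f y) ≤ dist (g x) (g y)) :
    AbsolutelyContinuousOnInterval f a b := by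
  rw [absolutelyContinuousOnInterval_iff] at hg ⊢
  intro ε hε
  obtain ⟨δ, hδ, H⟩ := hg ε hε
  exact ⟨δ, hδ, fun I hI hI' => (Finset.sum_le_sum fun i hi =>
    h _ (hI.1 i hi).1 _ (hI.1 i hi).2).trans_lt (H I hI hI')⟩

variable [NormedSpace ℝ E] [NormedSpace ℝ E₂]

/-- `F` is a primitive on `[0,ℓ]` of the square integrable function `f`, that is, `F` is the
continuous representative of an element of `H¹(0,ℓ)` with weak derivative `f`. -/
structure IsPrimitive (ℓ : ℝ) (F f : ℝ → E) : Prop where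
  memLp : MemLp f 2 (volume.restrict (Ioo 0 ℓ))
  eq_add_integral : ∀ x ∈ Icc 0 ℓ, F x = F 0 + ∫ t in 0..x, f t

lemma setIntegral_Ioo_eq_intervalIntegral (hℓ : 0 ≤ ℓ) (f : ℝ → E) :
    ∫ x in Ioo 0 ℓ, f x = ∫ x in (0 : ℝ)..ℓ, f x := by
  rw [intervalIntegral.integral_of_le hℓ, integral_Ioc_eq_integral_Ioo]

lemma isPrimitive_integral (c : E) {f : ℝ → E} (hf : MemLp f 2 (volume.restrict (Ioo 0 ℓ))) :
    IsPrimitive ℓ (fun x => c + ∫ t in 0..x, f t) f :=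
  ⟨hf, fun x _ => by simp⟩

lemma absolutelyContinuousOnInterval_of_eq_intervalIntegral {f F : ℝ → E} {a b : ℝ}
    (hf : IntervalIntegrable f volume a b)
    (hF : ∀ x ∈ uIcc a b, F x = F a + ∫ t in a..x, f t) : AbsolutelyContinuousOnInterval F a b := by
  have hi : ∀ x ∈ uIcc a b, IntervalIntegrable f volume a x := fun x hx =>
    hf.mono_set (uIcc_subset_uIcc_left hx)
  refine absolutelyContinuousOnInterval_of_dist_le
    (hf.norm.absolutelyContinuousOnInterval_intervalIntegral left_mem_uIcc) fun x hx y hy => ?_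
  rw [dist_eq_norm, dist_eq_norm, hF x hx, hF y hy, add_sub_add_left_eq_sub,
    intervalIntegral.integral_interval_sub_left (hi x hx) (hi y hy),
    intervalIntegral.integral_interval_sub_left (hi x hx).norm (hi y hy).norm]
  exact intervalIntegral.norm_integral_le_abs_integral_norm

namespace IsPrimitive

variable {F G f g : ℝ → E}

lemma sub_eq_integral (h : IsPrimitive ℓ F f) {x y : ℝ} (hx : x ∈ Icc 0 ℓ) (hy : y ∈ Icc 0 ℓ) :
    F y - F x = ∫ t in x..y, f t := by
  have h₀ : (0 : ℝ) ∈ Icc 0 ℓ := left_mem_Icc.2 (hx.1.trans hx.2)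
  rw [h.eq_add_integral x hx, h.eq_add_integral y hy, add_sub_add_left_eq_sub]
  exact intervalIntegral.integral_interval_sub_left (intervalIntegrable_of_memLp h.memLp h₀ hy)
    (intervalIntegrable_of_memLp h.memLp h₀ hx)

lemma eq_sub_integral_right (h : IsPrimitive ℓ F f) {x : ℝ} (hx : x ∈ Icc 0 ℓ) :
    F x = F ℓ - ∫ t in x..ℓ, f t := by
  rw [← h.sub_eq_integral hx (right_mem_Icc.2 (hx.1.trans hx.2)), sub_sub_cancel]

lemma absolutelyContinuousOnInterval (hℓ : 0 < ℓ) (h : IsPrimitive ℓ F f) :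
    AbsolutelyContinuousOnInterval F 0 ℓ :=
  absolutelyContinuousOnInterval_of_eq_intervalIntegral
    (intervalIntegrable_of_memLp h.memLp (left_mem_Icc.2 hℓ.le) (right_mem_Icc.2 hℓ.le))
    fun x hx => h.eq_add_integral x (by rwa [uIcc_of_le hℓ.le] at hx)

lemma continuousOn (hℓ : 0 < ℓ) (h : IsPrimitive ℓ F f) : ContinuousOn F (Icc 0 ℓ) := by
  simpa only [uIcc_of_le hℓ.le] using (h.absolutelyContinuousOnInterval hℓ).continuousOn

lemma congr_left (h : IsPrimitive ℓ F f) (hG : EqOn G F (Icc 0 ℓ)) : IsPrimitive ℓ G f := by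
  refine ⟨h.memLp, fun x hx => ?_⟩
  rw [hG hx, hG (left_mem_Icc.2 (hx.1.trans hx.2)), h.eq_add_integral x hx]

lemma congr_right (h : IsPrimitive ℓ F f) (hg : f =ᵐ[volume.restrict (Ioo 0 ℓ)] g) :
    IsPrimitive ℓ F g := by
  refine ⟨h.memLp.ae_eq hg, fun x hx => ?_⟩
  rw [h.eq_add_integral x hx, intervalIntegral.integral_congr_ae_restrict]
  rw [uIoc_of_le hx.1, ← restrict_Ioo_eq_restrict_Ioc]
  exact ae_restrict_of_ae_restrict_of_subset (Ioo_subset_Ioo_right hx.2) hg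

lemma congr_right_of_eqOn (h : IsPrimitive ℓ F f) (hg : EqOn f g (Icc 0 ℓ)) :
    IsPrimitive ℓ F g :=
  h.congr_right (ae_restrict_of_forall_mem measurableSet_Ioo fun _ hx =>
    hg (Ioo_subset_Icc_self hx))

lemma add (hF : IsPrimitive ℓ F f) (hG : IsPrimitive ℓ G g) :
    IsPrimitive ℓ (fun x => F x + G x) (fun x => f x + g x) := by
  refine ⟨hF.memLp.add hG.memLp, fun x hx => ?_⟩
  have h₀ : (0 : ℝ) ∈ Icc 0 ℓ := left_mem_Icc.2 (hx.1.trans hx.2)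
  rw [intervalIntegral.integral_add (intervalIntegrable_of_memLp hF.memLp h₀ hx)
    (intervalIntegrable_of_memLp hG.memLp h₀ hx), hF.eq_add_integral x hx,
    hG.eq_add_integral x hx, add_add_add_comm]

lemma clm_comp [CompleteSpace E] [CompleteSpace E₂] (hF : IsPrimitive ℓ F f) (L : E →L[ℝ] E₂) :
    IsPrimitive ℓ (fun x => L (F x)) (fun x => L (f x)) := by
  refine ⟨L.comp_memLp' hF.memLp, fun x hx => ?_⟩
  rw [L.intervalIntegral_comp_comm (intervalIntegrable_of_memLp hF.memLp
    (left_mem_Icc.2 (hx.1.trans hx.2)) hx), ← map_add, hF.eq_add_integral x hx]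

lemma neg (hF : IsPrimitive ℓ F f) : IsPrimitive ℓ (fun x => - F x) (fun x => - f x) := by
  refine ⟨hF.memLp.neg, fun x hx => ?_⟩
  rw [intervalIntegral.integral_neg, hF.eq_add_integral x hx, neg_add]

lemma sub (hF : IsPrimitive ℓ F f) (hG : IsPrimitive ℓ G g) :
    IsPrimitive ℓ (fun x => F x - G x) (fun x => f x - g x) := by
  simpa only [sub_eq_add_neg] using hF.add hG.neg

lemma ae_hasDerivAt [CompleteSpace E] (hℓ : 0 < ℓ) (h : IsPrimitive ℓ F f) :
    ∀ᵐ x ∂volume.restrict (Ioo 0 ℓ), HasDerivAt F (f x) x := by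
  have hi := intervalIntegrable_of_memLp h.memLp (left_mem_Icc.2 hℓ.le) (right_mem_Icc.2 hℓ.le)
  filter_upwards [ae_restrict_of_ae hi.ae_hasDerivAt_integral, ae_restrict_mem measurableSet_Ioo]
    with x hx hx'
  rw [uIcc_of_le hℓ.le] at hx
  refine ((hx (Ioo_subset_Icc_self hx') 0 (left_mem_Icc.2 hℓ.le)).const_add
    (F 0)).congr_of_eventuallyEq ?_
  filter_upwards [Icc_mem_nhds hx'.1 hx'.2] with y hy using h.eq_add_integral y hy

lemma of_ae_hasDerivAt [CompleteSpace E] (hℓ : 0 < ℓ) (hF : AbsolutelyContinuousOnInterval F 0 ℓ)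
    (hf : MemLp f 2 (volume.restrict (Ioo 0 ℓ)))
    (h : ∀ᵐ x ∂volume.restrict (Ioo 0 ℓ), HasDerivAt F (f x) x) : IsPrimitive ℓ F f := by
  have hI := isPrimitive_integral (F 0) hf
  have hderiv : ∀ᵐ x, x ∈ uIcc 0 ℓ →
      HasDerivAt (F - fun x => F 0 + ∫ t in 0..x, f t) 0 x := by
    rw [uIcc_of_le hℓ.le, ← ae_restrict_iff' measurableSet_Icc, ← restrict_Ioo_eq_restrict_Icc]
    filter_upwards [h, hI.ae_hasDerivAt hℓ] with x hx hx'
    simpa using hx.sub hx'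
  obtain ⟨C, hC⟩ := (hF.sub (hI.absolutelyContinuousOnInterval hℓ)).const_of_ae_hasDerivAt_zero
    hderiv
  have hC₀ : 0 = C := by simpa using hC 0 left_mem_uIcc
  refine ⟨hf, fun x hx => ?_⟩
  have hCx := hC x (by rwa [uIcc_of_le hℓ.le])
  rwa [← hC₀, Pi.sub_apply, sub_eq_zero] at hCx

section SMul

variable {𝕜 : Type*} [RCLike 𝕜] [NormedSpace 𝕜 E] {Φ φ : ℝ → 𝕜}

lemma memLp_smul_left (hℓ : 0 < ℓ) (hΦ : IsPrimitive ℓ Φ φ) (hF : IsPrimitive ℓ F f) :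
    MemLp (fun x => φ x • F x) 2 (volume.restrict (Ioo 0 ℓ)) :=
  (memLp_of_continuousOn (hF.continuousOn hℓ) (p := ⊤)).smul hΦ.memLp

lemma memLp_smul_right (hℓ : 0 < ℓ) (hΦ : IsPrimitive ℓ Φ φ) (hF : IsPrimitive ℓ F f) :
    MemLp (fun x => Φ x • f x) 2 (volume.restrict (Ioo 0 ℓ)) :=
  hF.memLp.smul (memLp_of_continuousOn (hΦ.continuousOn hℓ) (p := ⊤))

variable [IsScalarTower ℝ 𝕜 E] [CompleteSpace E]

lemma smul (hℓ : 0 < ℓ) (hΦ : IsPrimitive ℓ Φ φ) (hF : IsPrimitive ℓ F f) :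
    IsPrimitive ℓ (fun x => Φ x • F x) (fun x => Φ x • f x + φ x • F x) := by
  refine of_ae_hasDerivAt hℓ ((hΦ.absolutelyContinuousOnInterval hℓ).fun_smul
    (hF.absolutelyContinuousOnInterval hℓ))
    ((memLp_smul_right hℓ hΦ hF).add (memLp_smul_left hℓ hΦ hF)) ?_
  filter_upwards [hΦ.ae_hasDerivAt hℓ, hF.ae_hasDerivAt hℓ] with x hx hx'
  exact hx.fun_smul hx'

lemma integral_smul_add_integral_smul (hℓ : 0 < ℓ) (hΦ : IsPrimitive ℓ Φ φ)
    (hF : IsPrimitive ℓ F f) :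
    (∫ x in (0 : ℝ)..ℓ, Φ x • f x) + ∫ x in (0 : ℝ)..ℓ, φ x • F x
      = Φ ℓ • F ℓ - Φ 0 • F 0 := by
  have h₀ : (0 : ℝ) ∈ Icc 0 ℓ := left_mem_Icc.2 hℓ.le
  have h₁ : ℓ ∈ Icc 0 ℓ := right_mem_Icc.2 hℓ.le
  rw [(smul hℓ hΦ hF).sub_eq_integral h₀ h₁, intervalIntegral.integral_add]
  · exact intervalIntegrable_of_memLp (memLp_smul_right hℓ hΦ hF) h₀ h₁
  · exact intervalIntegrable_of_memLp (memLp_smul_left hℓ hΦ hF) h₀ h₁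

end SMul

lemma of_hasDerivWithinAt [CompleteSpace E] (hf : ContinuousOn f (Icc 0 ℓ))
    (h : ∀ x ∈ Icc 0 ℓ, HasDerivWithinAt F (f x) (Icc 0 ℓ) x) : IsPrimitive ℓ F f := by
  refine ⟨memLp_of_continuousOn hf, fun x hx => ?_⟩
  have hs : Icc 0 x ⊆ Icc 0 ℓ := Icc_subset_Icc_right hx.2
  rw [intervalIntegral.integral_eq_sub_of_hasDerivAt_of_le hx.1
    (fun y hy => (h y (hs hy)).continuousWithinAt.mono hs)
    (fun y hy => (h y (hs (Ioo_subset_Icc_self hy))).hasDerivAt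
      (Icc_mem_nhds hy.1 (hy.2.trans_le hx.2)))
    (intervalIntegrable_of_memLp (memLp_of_continuousOn hf)
      (left_mem_Icc.2 (hx.1.trans hx.2)) hx), add_sub_cancel]

lemma hasDerivWithinAt [CompleteSpace E] (h : IsPrimitive ℓ F f) (hf : ContinuousOn f (Icc 0 ℓ))
    {x : ℝ} (hx : x ∈ Icc 0 ℓ) : HasDerivWithinAt F (f x) (Icc 0 ℓ) x := by
  have hℓ : 0 ≤ ℓ := hx.1.trans hx.2
  have : Fact (x ∈ Icc 0 ℓ) := ⟨hx⟩
  have hd := (intervalIntegral.integral_hasDerivWithinAt_right (s := Icc 0 ℓ) (t := Icc 0 ℓ)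
    (intervalIntegrable_of_memLp h.memLp (left_mem_Icc.2 hℓ) hx)
    (hf.stronglyMeasurableAtFilter_nhdsWithin measurableSet_Icc x) (hf x hx)).const_add (F 0)
  exact hd.congr_of_mem h.eq_add_integral hx

end IsPrimitive

end Primitives

/-! ### Weak derivatives and primitives -/

lemma tsupport_integral_subset {E : Type*} [NormedAddCommGroup E] [NormedSpace ℝ E] {ζ : ℝ → E}
    {a b : ℝ} (hs : Function.support ζ ⊆ Ioo a b) (hi : ∫ x, ζ x = 0) :
    tsupport (fun x => ∫ t in a..x, ζ t) ⊆ Icc a b := by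
  refine closure_minimal (fun x hx => ?_) isClosed_Icc
  contrapose! hx
  rw [Function.notMem_support]
  rcases not_and_or.1 hx with hxa | hxb
  · have hzero : EqOn ζ 0 (uIcc a x) := fun t ht => Function.notMem_support.1 fun ht' =>
      (hs ht').1.not_ge (uIcc_of_ge (not_le.1 hxa).le ▸ ht).2
    rw [intervalIntegral.integral_congr hzero]
    exact intervalIntegral.integral_zero
  · rw [intervalIntegral.integral_eq_integral_of_support_subset
      (hs.trans fun t ht => ⟨ht.1, (ht.2.trans (not_le.1 hxb)).le⟩), hi]

lemma exists_subset_Ioo_of_isCompact {K : Set ℝ} (hK : IsCompact K) {c d : ℝ} (hcd : c < d)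
    (h : K ⊆ Ioo c d) : ∃ a b, c < a ∧ b < d ∧ K ⊆ Ioo a b := by
  rcases K.eq_empty_or_nonempty with rfl | hne
  · exact ⟨d, c, hcd, hcd, empty_subset _⟩
  obtain ⟨a, ha⟩ := hK.exists_isLeast hne
  obtain ⟨b, hb⟩ := hK.exists_isGreatest hne
  obtain ⟨a', ha', haa₁⟩ := exists_between (h ha.1).1
  obtain ⟨b', hbb₁, hb'⟩ := exists_between (h hb.1).2
  exact ⟨a', b', ha', hb', fun x hx => ⟨haa₁.trans_le (ha.2 hx), (hb.2 hx).trans_lt hbb₁⟩⟩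

/-- Test functions on `(0,ℓ)`. -/
structure IsTestFunction (ℓ : ℝ) (φ : ℝ → ℝ) : Prop where
  contDiff : ContDiff ℝ (⊤ : ℕ∞) φ
  hasCompactSupport : HasCompactSupport φ
  tsupport_subset : tsupport φ ⊆ Ioo 0 ℓ

namespace IsTestFunction

variable {φ ψ : ℝ → ℝ} {ℓ : ℝ}

lemma eq_zero (h : IsTestFunction ℓ φ) {x : ℝ} (hx : x ∉ Ioo 0 ℓ) : φ x = 0 :=
  image_eq_zero_of_notMem_tsupport fun hx' => hx (h.tsupport_subset hx')

lemma sub_const_mul (hφ : IsTestFunction ℓ φ) (hψ : IsTestFunction ℓ ψ) (c : ℝ) :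
    IsTestFunction ℓ fun x => φ x - c * ψ x where
  contDiff := hφ.contDiff.sub (contDiff_const.mul hψ.contDiff)
  hasCompactSupport := hφ.hasCompactSupport.sub hψ.hasCompactSupport.mul_left
  tsupport_subset := (tsupport_sub _ _).trans <| union_subset hφ.tsupport_subset <|
    tsupport_mul_subset_right.trans hψ.tsupport_subset

lemma integrable (h : IsTestFunction ℓ φ) : Integrable φ :=
  h.contDiff.continuous.integrable_of_hasCompactSupport h.hasCompactSupport

lemma integrable_smul {E : Type*} [NormedAddCommGroup E] [NormedSpace ℝ E]
    (h : IsTestFunction ℓ φ) {f : ℝ → E} (hf : MemLp f 2 (volume.restrict (Ioo 0 ℓ))) :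
    Integrable (fun x => φ x • f x) (volume.restrict (Ioo 0 ℓ)) :=
  integrable_smul_of_memLp h.contDiff.continuous h.hasCompactSupport hf

lemma isPrimitive (h : IsTestFunction ℓ φ) : IsPrimitive ℓ φ (deriv φ) :=
  .of_hasDerivWithinAt (h.contDiff.continuous_deriv (by simp)).continuousOn fun x _ =>
    (h.contDiff.differentiable (by simp) x).hasDerivAt.hasDerivWithinAt

lemma exists_integral_eq_one (hℓ : 0 < ℓ) : ∃ ψ, IsTestFunction ℓ ψ ∧ ∫ x, ψ x = 1 := by
  let B : ContDiffBump (ℓ / 2) := ⟨ℓ / 8, ℓ / 4, by linarith, by linarith⟩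
  refine ⟨B.normed volume, ⟨B.contDiff_normed, B.hasCompactSupport_normed, ?_⟩, B.integral_normed⟩
  rw [B.tsupport_normed_eq, Real.closedBall_eq_Icc]
  exact Icc_subset_Ioo (by simp only [B]; linarith) (by simp only [B]; linarith)

lemma exists_deriv_eq (hℓ : 0 < ℓ) (hφ : IsTestFunction ℓ φ) (hi : ∫ x, φ x = 0) :
    ∃ ψ, IsTestFunction ℓ ψ ∧ deriv ψ = φ := by
  obtain ⟨a, b, ha, hb, hab⟩ := exists_subset_Ioo_of_isCompact hφ.hasCompactSupport hℓ
    hφ.tsupport_subset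
  have hd (x : ℝ) : HasDerivAt (fun x => ∫ t in a..x, φ t) (φ x) x :=
    hφ.contDiff.continuous.integral_hasStrictDerivAt a x |>.hasDerivAt
  have hderiv : deriv (fun x => ∫ t in a..x, φ t) = φ := funext fun x => (hd x).deriv
  have hs := tsupport_integral_subset ((subset_tsupport _).trans hab) hi
  refine ⟨_, ⟨contDiff_infty_iff_deriv.2 ⟨fun x => (hd x).differentiableAt, ?_⟩,
    .of_support_subset_isCompact isCompact_Icc ((subset_tsupport _).trans hs),
    hs.trans (Icc_subset_Ioo ha hb)⟩, hderiv⟩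
  rw [hderiv]
  exact hφ.contDiff

end IsTestFunction

section WeakDerivatives

variable {E : Type*} [NormedAddCommGroup E] [NormedSpace ℝ E] {ℓ : ℝ} {f f' g F : ℝ → E}

lemma IsPrimitive.hasWeakDeriv [CompleteSpace E] (hℓ : 0 < ℓ) (h : IsPrimitive ℓ F f) :
    HasWeakDeriv ℓ F f := by
  refine ⟨memLp_of_continuousOn (h.continuousOn hℓ), h.memLp, fun φ hφ hc hs => ?_⟩
  have ht : IsTestFunction ℓ φ := ⟨hφ, hc, hs⟩
  have hparts := IsPrimitive.integral_smul_add_integral_smul hℓ ht.isPrimitive h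
  rw [ht.eq_zero left_notMem_Ioo, ht.eq_zero right_notMem_Ioo, zero_smul, zero_smul,
    sub_zero] at hparts
  rw [setIntegral_Ioo_eq_intervalIntegral hℓ.le, setIntegral_Ioo_eq_intervalIntegral hℓ.le]
  exact eq_neg_of_add_eq_zero_right hparts

lemma HasWeakDeriv.sub {g' : ℝ → E} (h : HasWeakDeriv ℓ f g) (h' : HasWeakDeriv ℓ f' g') :
    HasWeakDeriv ℓ (fun x => f x - f' x) (fun x => g x - g' x) := by
  refine ⟨h.memLp_fun.sub h'.memLp_fun, h.memLp_deriv.sub h'.memLp_deriv, fun φ hφ hc hs => ?_⟩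
  have ht : IsTestFunction ℓ φ := ⟨hφ, hc, hs⟩
  have hd : Continuous (deriv φ) := hφ.continuous_deriv (by simp)
  simp only [smul_sub]
  rw [integral_sub (integrable_smul_of_memLp hd hc.deriv h.memLp_fun)
      (integrable_smul_of_memLp hd hc.deriv h'.memLp_fun),
    integral_sub (ht.integrable_smul h.memLp_deriv) (ht.integrable_smul h'.memLp_deriv),
    h.integral_eq φ hφ hc hs, h'.integral_eq φ hφ hc hs, neg_sub_neg, neg_sub]

lemma HasWeakDeriv.congr_ae (h : HasWeakDeriv ℓ f g)
    (hf : f' =ᵐ[volume.restrict (Ioo 0 ℓ)] f) : HasWeakDeriv ℓ f' g := by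
  refine ⟨h.memLp_fun.ae_eq hf.symm, h.memLp_deriv, fun φ hφ hc hs => ?_⟩
  rw [← h.integral_eq φ hφ hc hs]
  exact integral_congr_ae (hf.mono fun x hx => by simp only [hx])

variable [CompleteSpace E]

lemma ae_eq_zero_of_forall_integral_smul_eq_zero (hf : MemLp f 2 (volume.restrict (Ioo 0 ℓ)))
    (h : ∀ φ, IsTestFunction ℓ φ → ∫ x in Ioo 0 ℓ, φ x • f x = 0) :
    f =ᵐ[volume.restrict (Ioo 0 ℓ)] 0 := by
  have hi : IntegrableOn f (Ioo 0 ℓ) := hf.integrable one_le_two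
  rw [Filter.EventuallyEq, ae_restrict_iff' measurableSet_Ioo]
  refine isOpen_Ioo.ae_eq_zero_of_integral_contDiff_smul_eq_zero hi.locallyIntegrableOn
    fun φ hφ hc hs => ?_
  have ht : IsTestFunction ℓ φ := ⟨hφ, hc, hs⟩
  rw [← h φ ht, setIntegral_eq_integral_of_forall_compl_eq_zero]
  exact fun x hx => by rw [ht.eq_zero hx, zero_smul]

/-- Du Bois-Reymond's lemma: subtracting a multiple of a fixed bump turns an arbitrary test function
into one with mean zero, which is the derivative of a test function. -/
lemma HasWeakDeriv.exists_ae_eq_const (hℓ : 0 < ℓ) (h : HasWeakDeriv ℓ f 0) :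
    ∃ c : E, f =ᵐ[volume.restrict (Ioo 0 ℓ)] fun _ => c := by
  obtain ⟨ψ, hψ, hψ₁⟩ := IsTestFunction.exists_integral_eq_one hℓ
  set c := ∫ x in Ioo 0 ℓ, ψ x • f x
  have hcm : MemLp (fun _ : ℝ => c) 2 (volume.restrict (Ioo 0 ℓ)) :=
    memLp_of_continuousOn continuousOn_const
  suffices h₀ : (fun x => f x - c) =ᵐ[volume.restrict (Ioo 0 ℓ)] 0 from
    ⟨c, h₀.mono fun x hx => sub_eq_zero.1 hx⟩
  refine ae_eq_zero_of_forall_integral_smul_eq_zero (h.memLp_fun.sub hcm) fun η hη => ?_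
  set m := ∫ x, η x
  have hmean : ∫ x, (η x - m * ψ x) = 0 := by
    rw [integral_sub hη.integrable (hψ.integrable.const_mul m), integral_const_mul, hψ₁, mul_one,
      sub_self]
  obtain ⟨φ, hφ, hφ'⟩ := (hη.sub_const_mul hψ m).exists_deriv_eq hℓ hmean
  have hηf : ∫ x in Ioo 0 ℓ, η x • f x = m • c := by
    have h₀ := h.integral_eq φ hφ.contDiff hφ.hasCompactSupport hφ.tsupport_subset
    simp only [hφ', Pi.zero_apply, smul_zero, integral_zero, neg_zero, sub_smul, mul_smul] at h₀
    rwa [integral_sub (hη.integrable_smul h.memLp_fun)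
      ((hψ.integrable_smul h.memLp_fun).fun_smul m), integral_smul, sub_eq_zero] at h₀
  have hηc : ∫ x in Ioo 0 ℓ, η x • c = m • c := by
    rw [integral_smul_const, setIntegral_eq_integral_of_forall_compl_eq_zero
      fun x hx => hη.eq_zero hx]
  simp only [smul_sub]
  rw [integral_sub (hη.integrable_smul h.memLp_fun) (hη.integrable_smul hcm), hηf, hηc, sub_self]

lemma HasWeakDeriv.exists_isPrimitive (hℓ : 0 < ℓ) (h : HasWeakDeriv ℓ f g) :
    ∃ F, IsPrimitive ℓ F g ∧ f =ᵐ[volume.restrict (Ioo 0 ℓ)] F := by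
  have h₀ := h.sub ((isPrimitive_integral 0 h.memLp_deriv).hasWeakDeriv hℓ)
  simp only [sub_self] at h₀
  obtain ⟨c, hc⟩ := h₀.exists_ae_eq_const hℓ
  refine ⟨fun x => c + ∫ t in 0..x, g t, isPrimitive_integral c h.memLp_deriv, ?_⟩
  filter_upwards [hc] with x hx
  rw [← hx, zero_add, sub_add_cancel]

lemma IsPrimitive.ae_eq_zero (hℓ : 0 < ℓ) (h : IsPrimitive ℓ F f) (hF : ∀ x ∈ Icc 0 ℓ, F x = 0) :
    f =ᵐ[volume.restrict (Ioo 0 ℓ)] 0 := by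
  filter_upwards [h.ae_hasDerivAt hℓ, ae_restrict_mem measurableSet_Ioo] with x hx hx'
  refine hx.unique ((hasDerivAt_const x (0 : E)).congr_of_eventuallyEq ?_)
  filter_upwards [Icc_mem_nhds hx'.1 hx'.2] with y hy using hF y hy

end WeakDerivatives

/-! ### The boundary value problem as a first order system -/

section Regularity

variable {E : Type*} [NormedAddCommGroup E] [NormedSpace ℝ E] [CompleteSpace E] {ℓ : ℝ}
  {F f : ℝ → E}

namespace IsPrimitive

lemma eqOn_derivWithin (hℓ : 0 < ℓ) (h : IsPrimitive ℓ F f) (hf : ContinuousOn f (Icc 0 ℓ)) :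
    EqOn (derivWithin F (Icc 0 ℓ)) f (Icc 0 ℓ) := fun x hx =>
  (h.hasDerivWithinAt hf hx).derivWithin (uniqueDiffOn_Icc hℓ x hx)

lemma eqOn_iteratedDerivWithin_two (hℓ : 0 < ℓ) {f₂ : ℝ → E} (h : IsPrimitive ℓ F f)
    (h' : IsPrimitive ℓ f f₂) (hf₂ : ContinuousOn f₂ (Icc 0 ℓ)) :
    EqOn (iteratedDerivWithin 2 F (Icc 0 ℓ)) f₂ (Icc 0 ℓ) := by
  intro x hx
  have hF := h.eqOn_derivWithin hℓ (h'.continuousOn hℓ)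
  rw [iteratedDerivWithin_succ, iteratedDerivWithin_one, derivWithin_congr hF (hF hx),
    h'.eqOn_derivWithin hℓ hf₂ hx]

lemma contDiffOn_succ (hℓ : 0 < ℓ) {n : ℕ} (h : IsPrimitive ℓ F f)
    (hf : ContDiffOn ℝ n f (Icc 0 ℓ)) : ContDiffOn ℝ (n + 1 : ℕ) F (Icc 0 ℓ) := by
  rw [Nat.cast_succ, contDiffOn_succ_iff_derivWithin (uniqueDiffOn_Icc hℓ)]
  exact ⟨fun x hx => (h.hasDerivWithinAt hf.continuousOn hx).differentiableWithinAt, by simp,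
    hf.congr (h.eqOn_derivWithin hℓ hf.continuousOn)⟩

lemma inv {φ φ' : ℝ → ℝ} (hℓ : 0 < ℓ) (h : IsPrimitive ℓ φ φ') (hφ' : ContinuousOn φ' (Icc 0 ℓ))
    (h₀ : ∀ x ∈ Icc 0 ℓ, φ x ≠ 0) :
    IsPrimitive ℓ (fun x => (φ x)⁻¹) (fun x => (φ x)⁻¹ • (φ x)⁻¹ • - φ' x) := by
  have hφi := (h.continuousOn hℓ).inv₀ h₀
  refine of_hasDerivWithinAt (hφi.smul (hφi.smul hφ'.neg)) fun x hx => ?_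
  convert! (h.hasDerivWithinAt hφ' hx).fun_inv (h₀ x hx) using 1
  simp only [smul_eq_mul, ← inv_pow, div_eq_mul_inv]
  ring

end IsPrimitive

lemma memDomain_of_isPrimitive (hℓ : 0 < ℓ) {u u₁ u₂ u₃ u₄ : ℝ → ℂ} (h : IsPrimitive ℓ u u₁)
    (h₁ : IsPrimitive ℓ u₁ u₂) (h₂ : IsPrimitive ℓ u₂ u₃) (h₃ : IsPrimitive ℓ u₃ u₄)
    (left : u 0 = 0) (left_deriv : u₁ 0 = 0) (right : u ℓ = 0) (right_deriv : u₁ ℓ = 0) :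
    MemDomain ℓ u where
  memH := ⟨_, h.hasWeakDeriv hℓ, _, h₁.hasWeakDeriv hℓ, _, h₂.hasWeakDeriv hℓ, _,
    h₃.hasWeakDeriv hℓ, h₃.memLp⟩
  contDiffOn := h.contDiffOn_succ hℓ <| h₁.contDiffOn_succ hℓ <| h₂.contDiffOn_succ hℓ <|
    contDiffOn_zero.2 (h₃.continuousOn hℓ)
  left := left
  deriv_left := (h.eqOn_derivWithin hℓ (h₁.continuousOn hℓ) (left_mem_Icc.2 hℓ.le)).trans left_deriv
  right := right
  deriv_right :=
    (h.eqOn_derivWithin hℓ (h₁.continuousOn hℓ) (right_mem_Icc.2 hℓ.le)).trans right_deriv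

lemma MemDomain.isPrimitive_derivWithin (hℓ : 0 < ℓ) {u : ℝ → ℂ} (h : MemDomain ℓ u) :
    IsPrimitive ℓ u (derivWithin u (Icc 0 ℓ)) :=
  .of_hasDerivWithinAt (h.contDiffOn.derivWithin (m := 2) (uniqueDiffOn_Icc hℓ)
    (by norm_num)).continuousOn fun _ hx => (h.differentiableWithinAt hx).hasDerivWithinAt

lemma MemDomain.isPrimitive_iteratedDerivWithin_two (hℓ : 0 < ℓ) {u : ℝ → ℂ} (h : MemDomain ℓ u) :
    IsPrimitive ℓ (derivWithin u (Icc 0 ℓ)) (iteratedDerivWithin 2 u (Icc 0 ℓ)) := by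
  have hU := uniqueDiffOn_Icc hℓ
  have h₁ := h.contDiffOn.derivWithin (m := 2) hU (by norm_num)
  have h₂ : iteratedDerivWithin 2 u (Icc 0 ℓ) =
      derivWithin (derivWithin u (Icc 0 ℓ)) (Icc 0 ℓ) := by
    rw [iteratedDerivWithin_succ, iteratedDerivWithin_one]
  rw [h₂]
  exact .of_hasDerivWithinAt (h₁.derivWithin (m := 1) hU (by norm_num)).continuousOn fun x hx =>
    (h₁.differentiableOn (by norm_num) x hx).hasDerivWithinAt

end Regularity

/-- The coefficients of the beam: `s ∈ H²(0,ℓ)` is the flexural stiffness `σ`, `k ∈ H¹(0,ℓ)` the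
tension `q` and `p` the density `ρ`, all given by their continuous representatives. -/
structure BeamCoeffs (ℓ : ℝ) (s k p : ℝ → ℝ) : Prop where
  pos : 0 < ℓ
  exists_isPrimitive_s : ∃ s' s'', IsPrimitive ℓ s s' ∧ IsPrimitive ℓ s' s''
  exists_isPrimitive_k : ∃ k', IsPrimitive ℓ k k'
  continuousOn_p : ContinuousOn p (Icc 0 ℓ)
  s_pos : ∀ x ∈ Icc 0 ℓ, 0 < s x
  k_nonneg : ∀ x ∈ Icc 0 ℓ, 0 ≤ k x
  p_pos : ∀ x ∈ Icc 0 ℓ, 0 < p x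

/-- The beam coefficients `s`, `k`, `p` are the continuous representatives of `σ`, `q`, `ρ`. -/
structure IsRepresentative (ℓ : ℝ) (σ q ρ s k p : ℝ → ℝ) : Prop extends BeamCoeffs ℓ s k p where
  s_ae_eq : σ =ᵐ[volume.restrict (Ioo 0 ℓ)] s
  k_ae_eq : q =ᵐ[volume.restrict (Ioo 0 ℓ)] k
  p_ae_eq : ρ =ᵐ[volume.restrict (Ioo 0 ℓ)] p

/-- The clamped problem `(s u'')'' - (k u')' = g`, `u = u' = 0` at `0` and `ℓ`, as a first order
system for `u`, `u₁ = u'`, the bending moment `m = s u''` and the shear force `t = m' - k u'`. -/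
structure IsClampedSolution {E : Type*} [NormedAddCommGroup E] [NormedSpace ℝ E] (ℓ : ℝ)
    (s k : ℝ → ℝ) (g u u₁ m t : ℝ → E) : Prop where
  isPrimitive_u : IsPrimitive ℓ u u₁
  isPrimitive_u₁ : IsPrimitive ℓ u₁ (fun x => (s x)⁻¹ • m x)
  isPrimitive_m : IsPrimitive ℓ m (fun x => t x + k x • u₁ x)
  isPrimitive_t : IsPrimitive ℓ t g
  left : u 0 = 0
  left_deriv : u₁ 0 = 0
  right : u ℓ = 0
  right_deriv : u₁ ℓ = 0

namespace BeamCoeffs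

variable {ℓ : ℝ} {s k p : ℝ → ℝ}

lemma continuousOn_s (B : BeamCoeffs ℓ s k p) : ContinuousOn s (Icc 0 ℓ) :=
  let ⟨_, _, h, _⟩ := B.exists_isPrimitive_s
  h.continuousOn B.pos

lemma continuousOn_k (B : BeamCoeffs ℓ s k p) : ContinuousOn k (Icc 0 ℓ) :=
  let ⟨_, h⟩ := B.exists_isPrimitive_k
  h.continuousOn B.pos

lemma continuousOn_inv_s (B : BeamCoeffs ℓ s k p) : ContinuousOn (fun x => (s x)⁻¹) (Icc 0 ℓ) :=
  B.continuousOn_s.inv₀ fun x hx => (B.s_pos x hx).ne'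

lemma exists_isPrimitive_inv_s (B : BeamCoeffs ℓ s k p) :
    ∃ r' r'', IsPrimitive ℓ (fun x => (s x)⁻¹) r' ∧ IsPrimitive ℓ r' r'' := by
  obtain ⟨s', s'', hs, hs'⟩ := B.exists_isPrimitive_s
  have hr := hs.inv B.pos (hs'.continuousOn B.pos) fun x hx => (B.s_pos x hx).ne'
  exact ⟨_, _, hr, hr.smul B.pos (hr.smul B.pos hs'.neg)⟩

end BeamCoeffs

lemma exists_isRepresentative {ℓ : ℝ} (hℓ : 0 < ℓ) {σ q ρ : ℝ → ℝ} (hρH : MemH ℓ 1 ρ)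
    (hσH : MemH ℓ 2 σ) (hqH : MemH ℓ 1 q) {ρ₀ σ₀ : ℝ} (hρ₀ : 0 < ρ₀) (hσ₀ : 0 < σ₀)
    (hρ : ∀ x ∈ Icc 0 ℓ, ρ₀ ≤ ρ x) (hσ : ∀ x ∈ Icc 0 ℓ, σ₀ ≤ σ x) (hq : ∀ x ∈ Icc 0 ℓ, 0 ≤ q x) :
    ∃ s k p, IsRepresentative ℓ σ q ρ s k p := by
  obtain ⟨σ', hσ', σ'', hσ'', -⟩ := hσH
  obtain ⟨ρ', hρ', -⟩ := hρH
  obtain ⟨q', hq', -⟩ := hqH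
  obtain ⟨s, hs, hσs⟩ := hσ'.exists_isPrimitive hℓ
  obtain ⟨s', hs', hσs'⟩ := hσ''.exists_isPrimitive hℓ
  obtain ⟨p, hp, hρp⟩ := hρ'.exists_isPrimitive hℓ
  obtain ⟨k, hk, hqk⟩ := hq'.exists_isPrimitive hℓ
  exact ⟨s, k, p,
    { pos := hℓ
      exists_isPrimitive_s := ⟨s', σ'', hs.congr_right hσs', hs'⟩
      exists_isPrimitive_k := ⟨q', hk⟩
      continuousOn_p := hp.continuousOn hℓ
      s_pos := fun x hx =>
        hσ₀.trans_le (le_of_ae_eq_of_continuousOn hℓ (hs.continuousOn hℓ) hσs hσ x hx)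
      k_nonneg := le_of_ae_eq_of_continuousOn hℓ (hk.continuousOn hℓ) hqk hq
      p_pos := fun x hx =>
        hρ₀.trans_le (le_of_ae_eq_of_continuousOn hℓ (hp.continuousOn hℓ) hρp hρ x hx)
      s_ae_eq := hσs
      k_ae_eq := hqk
      p_ae_eq := hρp }⟩

namespace IsClampedSolution

section

variable {E E₂ : Type*} [NormedAddCommGroup E] [NormedSpace ℝ E] [NormedAddCommGroup E₂]
  [NormedSpace ℝ E₂] {ℓ : ℝ} {s k p : ℝ → ℝ} {g h u u₁ m t v v₁ n r : ℝ → E}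

lemma congr_right (H : IsClampedSolution ℓ s k g u u₁ m t)
    (e : g =ᵐ[volume.restrict (Ioo 0 ℓ)] h) : IsClampedSolution ℓ s k h u u₁ m t :=
  { H with isPrimitive_t := H.isPrimitive_t.congr_right e }

lemma clm_comp [CompleteSpace E] [CompleteSpace E₂] (H : IsClampedSolution ℓ s k g u u₁ m t)
    (L : E →L[ℝ] E₂) : IsClampedSolution ℓ s k (fun x => L (g x)) (fun x => L (u x))
      (fun x => L (u₁ x)) (fun x => L (m x)) (fun x => L (t x)) where
  isPrimitive_u := H.isPrimitive_u.clm_comp L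
  isPrimitive_u₁ := by simpa only [map_smul] using H.isPrimitive_u₁.clm_comp L
  isPrimitive_m := by simpa only [map_smul, map_add] using H.isPrimitive_m.clm_comp L
  isPrimitive_t := H.isPrimitive_t.clm_comp L
  left := by rw [H.left, map_zero]
  left_deriv := by rw [H.left_deriv, map_zero]
  right := by rw [H.right, map_zero]
  right_deriv := by rw [H.right_deriv, map_zero]

lemma sub (H : IsClampedSolution ℓ s k g u u₁ m t) (H' : IsClampedSolution ℓ s k h v v₁ n r) :
    IsClampedSolution ℓ s k (fun x => g x - h x) (fun x => u x - v x) (fun x => u₁ x - v₁ x)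
      (fun x => m x - n x) (fun x => t x - r x) where
  isPrimitive_u := H.isPrimitive_u.sub H'.isPrimitive_u
  isPrimitive_u₁ := by simpa only [smul_sub] using H.isPrimitive_u₁.sub H'.isPrimitive_u₁
  isPrimitive_m := by
    simpa only [smul_sub, add_sub_add_comm] using H.isPrimitive_m.sub H'.isPrimitive_m
  isPrimitive_t := H.isPrimitive_t.sub H'.isPrimitive_t
  left := by rw [H.left, H'.left, sub_self]
  left_deriv := by rw [H.left_deriv, H'.left_deriv, sub_self]
  right := by rw [H.right, H'.right, sub_self]
  right_deriv := by rw [H.right_deriv, H'.right_deriv, sub_self]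

lemma exists_isPrimitive_inv_smul [CompleteSpace E] (B : BeamCoeffs ℓ s k p)
    (H : IsClampedSolution ℓ s k g u u₁ m t) :
    ∃ w' w'', IsPrimitive ℓ (fun x => (s x)⁻¹ • m x) w' ∧ IsPrimitive ℓ w' w'' := by
  obtain ⟨r', r'', hr, hr'⟩ := B.exists_isPrimitive_inv_s
  obtain ⟨k', hk⟩ := B.exists_isPrimitive_k
  have hm' := H.isPrimitive_t.add (hk.smul B.pos H.isPrimitive_u₁)
  exact ⟨_, _, hr.smul B.pos H.isPrimitive_m,
    (hr.smul B.pos hm').add (hr'.smul B.pos H.isPrimitive_m)⟩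

end

variable {ℓ : ℝ} {σ q ρ s k p : ℝ → ℝ} {g u u₁ m t : ℝ → ℂ}

lemma eqOn_derivWithin (hℓ : 0 < ℓ) (H : IsClampedSolution ℓ s k g u u₁ m t) :
    EqOn (derivWithin u (Icc 0 ℓ)) u₁ (Icc 0 ℓ) :=
  H.isPrimitive_u.eqOn_derivWithin hℓ (H.isPrimitive_u₁.continuousOn hℓ)

lemma eqOn_iteratedDerivWithin_two (B : BeamCoeffs ℓ s k p)
    (H : IsClampedSolution ℓ s k g u u₁ m t) :
    EqOn (iteratedDerivWithin 2 u (Icc 0 ℓ)) (fun x => (s x)⁻¹ • m x) (Icc 0 ℓ) :=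
  H.isPrimitive_u.eqOn_iteratedDerivWithin_two B.pos H.isPrimitive_u₁
    (B.continuousOn_inv_s.smul (H.isPrimitive_m.continuousOn B.pos))

lemma memDomain (B : BeamCoeffs ℓ s k p) (H : IsClampedSolution ℓ s k g u u₁ m t) :
    MemDomain ℓ u := by
  obtain ⟨w', w'', hw, hw'⟩ := H.exists_isPrimitive_inv_smul B
  exact memDomain_of_isPrimitive B.pos H.isPrimitive_u H.isPrimitive_u₁ hw hw' H.left H.left_deriv
    H.right H.right_deriv

lemma solvesClamped (R : IsRepresentative ℓ σ q ρ s k p)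
    (H : IsClampedSolution ℓ s k g u u₁ m t) : SolvesClamped ℓ σ q u g := by
  have hℓ := R.pos
  obtain ⟨k', hk⟩ := R.exists_isPrimitive_k
  have hku := hk.smul hℓ H.isPrimitive_u₁
  refine ⟨H.memDomain R.toBeamCoeffs, _, _, _, (H.isPrimitive_m.hasWeakDeriv hℓ).congr_ae ?_,
    (H.isPrimitive_t.add hku).hasWeakDeriv hℓ, (hku.hasWeakDeriv hℓ).congr_ae ?_,
    .of_forall fun x => add_sub_cancel_right _ _⟩
  · filter_upwards [R.s_ae_eq, ae_restrict_mem measurableSet_Ioo] with x hx hx'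
    have hx'' := Ioo_subset_Icc_self hx'
    rw [hx, H.eqOn_iteratedDerivWithin_two R.toBeamCoeffs hx'',
      smul_inv_smul₀ (R.s_pos x hx'').ne']
  · filter_upwards [R.k_ae_eq, ae_restrict_mem measurableSet_Ioo] with x hx hx'
    rw [hx, H.eqOn_derivWithin hℓ (Ioo_subset_Icc_self hx')]

end IsClampedSolution

lemma SolvesClamped.exists_isClampedSolution {ℓ : ℝ} {σ q ρ s k p : ℝ → ℝ}
    (R : IsRepresentative ℓ σ q ρ s k p) {u g : ℝ → ℂ} (h : SolvesClamped ℓ σ q u g) :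
    ∃ u₁ m t, IsClampedSolution ℓ s k g u u₁ m t := by
  have hℓ := R.pos
  obtain ⟨hd, m₁, m₂, p₁, hm, hm₁, hp₁, he⟩ := h
  have hu := hd.isPrimitive_derivWithin hℓ
  have hu₁ := hd.isPrimitive_iteratedDerivWithin_two hℓ
  obtain ⟨M, hM, hmM⟩ := hm.exists_isPrimitive hℓ
  obtain ⟨M₁, hM₁, hmM₁⟩ := hm₁.exists_isPrimitive hℓ
  obtain ⟨P, hP, hpP⟩ := hp₁.exists_isPrimitive hℓ
  set u₁ := derivWithin u (Icc 0 ℓ)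
  have hu₁M : iteratedDerivWithin 2 u (Icc 0 ℓ) =ᵐ[volume.restrict (Ioo 0 ℓ)]
      fun x => (s x)⁻¹ • M x := by
    filter_upwards [hmM, R.s_ae_eq, ae_restrict_mem measurableSet_Ioo] with x hx hs hx'
    rw [← hx, hs, inv_smul_smul₀ (R.s_pos x (Ioo_subset_Icc_self hx')).ne']
  have hPk : EqOn (fun x => k x • u₁ x) P (Icc 0 ℓ) := by
    refine eqOn_Icc_of_ae_eq hℓ (R.continuousOn_k.smul (hu₁.continuousOn hℓ))
      (hP.continuousOn hℓ) ?_
    filter_upwards [hpP, R.k_ae_eq] with x hx hk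
    rw [← hx, hk]
  refine ⟨u₁, M, fun x => M₁ x - k x • u₁ x, hu, hu₁.congr_right hu₁M, hM.congr_right ?_,
    (hM₁.sub (hP.congr_left hPk)).congr_right he, hd.left, hd.deriv_left, hd.right,
    hd.deriv_right⟩
  filter_upwards [hmM₁] with x hx
  rw [hx, sub_add_cancel]

/-! ### Symmetry and energy -/

lemma IsPrimitive.eqOn_zero {E : Type*} [NormedAddCommGroup E] [NormedSpace ℝ E] {ℓ : ℝ}
    {F f : ℝ → E} (h : IsPrimitive ℓ F f) (h₀ : F 0 = 0) (hf : EqOn f 0 (Icc 0 ℓ)) :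
    EqOn F 0 (Icc 0 ℓ) := by
  intro x hx
  rw [h.eq_add_integral x hx, h₀, zero_add, intervalIntegral.integral_congr (g := 0),
    Pi.zero_apply, Pi.zero_def, intervalIntegral.integral_zero]
  rw [uIcc_of_le hx.1]
  exact hf.mono (Icc_subset_Icc_right hx.2)

lemma eqOn_zero_of_integral_mul_sq_norm_nonpos {E : Type*} [NormedAddCommGroup E] {a b : ℝ}
    (hab : a < b) {w : ℝ → ℝ} {f : ℝ → E} (hw : ContinuousOn w (Icc a b))
    (hw' : ∀ x ∈ Icc a b, 0 < w x) (hf : ContinuousOn f (Icc a b))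
    (h : ∫ x in a..b, w x * ‖f x‖ ^ 2 ≤ 0) : EqOn f 0 (Icc a b) := by
  intro x hx
  by_contra hfx
  refine h.not_gt (intervalIntegral.integral_pos hab (hw.mul (hf.norm.pow 2)) (fun y hy => ?_)
    ⟨x, hx, mul_pos (hw' x hx) (pow_pos (norm_pos_iff.2 hfx) 2)⟩)
  exact mul_nonneg (hw' y (Ioc_subset_Icc_self hy)).le (by positivity)

/-- Twice the elastic energy of a beam with slope `u₁` and bending moment `m`. -/
def energy {𝕜 : Type*} [RCLike 𝕜] (ℓ : ℝ) (s k : ℝ → ℝ) (u₁ m : ℝ → 𝕜) : ℝ :=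
  ∫ x in (0 : ℝ)..ℓ, (k x * ‖u₁ x‖ ^ 2 + (s x)⁻¹ * ‖m x‖ ^ 2)

namespace IsClampedSolution

variable {𝕜 : Type*} [RCLike 𝕜] {ℓ : ℝ} {s k p : ℝ → ℝ} {g h u u₁ m t v v₁ n r : ℝ → 𝕜}

lemma integral_mul_eq (B : BeamCoeffs ℓ s k p) (H : IsClampedSolution ℓ s k g u u₁ m t)
    (H' : IsClampedSolution ℓ s k h v v₁ n r) :
    ∫ x in (0 : ℝ)..ℓ, v x * g x =
      ∫ x in (0 : ℝ)..ℓ, (k x • (v₁ x * u₁ x) + (s x)⁻¹ • (n x * m x)) := by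
  have hℓ := B.pos
  have hI {f : ℝ → 𝕜} (hf : MemLp f 2 (volume.restrict (Ioo 0 ℓ))) :=
    intervalIntegrable_of_memLp hf (left_mem_Icc.2 hℓ.le) (right_mem_Icc.2 hℓ.le)
  have i₁ := hI (IsPrimitive.memLp_smul_right hℓ H'.isPrimitive_u₁ H.isPrimitive_m)
  have i₂ := hI (IsPrimitive.memLp_smul_left hℓ H'.isPrimitive_u₁ H.isPrimitive_m)
  have i₃ := hI (IsPrimitive.memLp_smul_left hℓ H'.isPrimitive_u H.isPrimitive_t)
  have e₁ := H'.isPrimitive_u.integral_smul_add_integral_smul hℓ H.isPrimitive_t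
  have e₂ := H'.isPrimitive_u₁.integral_smul_add_integral_smul hℓ H.isPrimitive_m
  simp only [H'.left, H'.right, H'.left_deriv, H'.right_deriv, zero_smul, sub_self] at e₁ e₂
  calc ∫ x in (0 : ℝ)..ℓ, v x * g x
      = (∫ x in (0 : ℝ)..ℓ, v₁ x • (t x + k x • u₁ x)) + (∫ x in (0 : ℝ)..ℓ, ((s x)⁻¹ • n x) • m x)
          - ∫ x in (0 : ℝ)..ℓ, v₁ x • t x := by
        rw [e₂, zero_sub]; exact eq_neg_of_add_eq_zero_left e₁
    _ = _ := by
        rw [← intervalIntegral.integral_add i₁ i₂, ← intervalIntegral.integral_sub (i₁.add i₂) i₃]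
        refine intervalIntegral.integral_congr fun x _ => ?_
        simp only [smul_eq_mul, RCLike.real_smul_eq_coe_mul]
        ring

lemma integral_mul_comm (B : BeamCoeffs ℓ s k p) (H : IsClampedSolution ℓ s k g u u₁ m t)
    (H' : IsClampedSolution ℓ s k h v v₁ n r) :
    ∫ x in (0 : ℝ)..ℓ, v x * g x = ∫ x in (0 : ℝ)..ℓ, u x * h x := by
  rw [H.integral_mul_eq B H', H'.integral_mul_eq B H]
  simp only [mul_comm]

lemma conj (H : IsClampedSolution ℓ s k g u u₁ m t) :
    IsClampedSolution ℓ s k (fun x => starRingEnd 𝕜 (g x)) (fun x => starRingEnd 𝕜 (u x))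
      (fun x => starRingEnd 𝕜 (u₁ x)) (fun x => starRingEnd 𝕜 (m x))
      (fun x => starRingEnd 𝕜 (t x)) :=
  H.clm_comp (RCLike.conjCLE (K := 𝕜) : 𝕜 →L[ℝ] 𝕜)

lemma integral_conj_mul_eq_energy (B : BeamCoeffs ℓ s k p)
    (H : IsClampedSolution ℓ s k g u u₁ m t) :
    ∫ x in (0 : ℝ)..ℓ, starRingEnd 𝕜 (u x) * g x = (energy ℓ s k u₁ m : 𝕜) := by
  rw [H.integral_mul_eq B H.conj, energy, ← RCLike.intervalIntegral_ofReal]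
  refine intervalIntegral.integral_congr fun x _ => ?_
  simp only [RCLike.conj_mul, RCLike.real_smul_eq_coe_mul]
  push_cast
  rfl

lemma energy_nonneg (B : BeamCoeffs ℓ s k p) : 0 ≤ energy ℓ s k u₁ m := by
  refine intervalIntegral.integral_nonneg B.pos.le fun x hx => ?_
  have := B.k_nonneg x hx
  have := B.s_pos x hx
  positivity

lemma eqOn_zero_of_energy_eq_zero (B : BeamCoeffs ℓ s k p)
    (H : IsClampedSolution ℓ s k g u u₁ m t) (hE : energy ℓ s k u₁ m = 0) :
    EqOn u 0 (Icc 0 ℓ) := by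
  have hℓ := B.pos
  have hm := H.isPrimitive_m.continuousOn hℓ
  have c₁ : ContinuousOn (fun x => k x * ‖u₁ x‖ ^ 2) (Icc 0 ℓ) :=
    B.continuousOn_k.mul ((H.isPrimitive_u₁.continuousOn hℓ).norm.pow 2)
  have c₂ : ContinuousOn (fun x => (s x)⁻¹ * ‖m x‖ ^ 2) (Icc 0 ℓ) :=
    B.continuousOn_inv_s.mul (hm.norm.pow 2)
  have hm₀ : EqOn m 0 (Icc 0 ℓ) := by
    refine eqOn_zero_of_integral_mul_sq_norm_nonpos hℓ B.continuousOn_inv_s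
      (fun x hx => inv_pos.2 (B.s_pos x hx)) hm (le_of_le_of_eq ?_ hE)
    refine intervalIntegral.integral_mono_on hℓ.le (c₂.intervalIntegrable_of_Icc hℓ.le)
      ((c₁.add c₂).intervalIntegrable_of_Icc hℓ.le) fun x hx => ?_
    have := B.k_nonneg x hx
    exact le_add_of_nonneg_left (by positivity)
  refine H.isPrimitive_u.eqOn_zero H.left (H.isPrimitive_u₁.eqOn_zero H.left_deriv fun x hx => ?_)
  simp [hm₀ hx]

lemma eqOn_zero (B : BeamCoeffs ℓ s k p) (H : IsClampedSolution ℓ s k g u u₁ m t)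
    (hg : g =ᵐ[volume.restrict (Ioo 0 ℓ)] 0) : EqOn u 0 (Icc 0 ℓ) := by
  refine H.eqOn_zero_of_energy_eq_zero B (RCLike.ofReal_injective (K := 𝕜) ?_)
  rw [← H.integral_conj_mul_eq_energy B, ← setIntegral_Ioo_eq_intervalIntegral B.pos.le,
    RCLike.ofReal_zero]
  refine integral_eq_zero_of_ae ?_
  filter_upwards [hg] with x hx
  simp [hx]

lemma eqOn (B : BeamCoeffs ℓ s k p) (H : IsClampedSolution ℓ s k g u u₁ m t)
    (H' : IsClampedSolution ℓ s k h v v₁ n r) (e : g =ᵐ[volume.restrict (Ioo 0 ℓ)] h) :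
    EqOn u v (Icc 0 ℓ) := fun _ hx =>
  sub_eq_zero.1 ((H.sub H').eqOn_zero B (by filter_upwards [e] with x hx; simp [hx]) hx)

lemma exists_pos_eq_ofReal (B : BeamCoeffs ℓ s k p) {z : 𝕜}
    (H : IsClampedSolution ℓ s k (fun x => p x • (z * u x)) u u₁ m t)
    (hu : ∃ x ∈ Icc 0 ℓ, u x ≠ 0) : ∃ a : ℝ, 0 < a ∧ z = a := by
  obtain ⟨x, hx, hux⟩ := hu
  set N := ∫ x in (0 : ℝ)..ℓ, p x * ‖u x‖ ^ 2 with hN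
  have hNpos : 0 < N := by
    by_contra! hle
    exact hux (eqOn_zero_of_integral_mul_sq_norm_nonpos B.pos B.continuousOn_p B.p_pos
      (H.isPrimitive_u.continuousOn B.pos) hle hx)
  have hEpos : 0 < energy ℓ s k u₁ m :=
    (energy_nonneg B).lt_of_ne' fun h₀ => hux (H.eqOn_zero_of_energy_eq_zero B h₀ hx)
  have rayleigh : z * N = energy ℓ s k u₁ m := by
    rw [← H.integral_conj_mul_eq_energy B, hN, ← RCLike.intervalIntegral_ofReal,
      ← intervalIntegral.integral_const_mul]
    refine intervalIntegral.integral_congr fun x _ => ?_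
    simp only [RCLike.real_smul_eq_coe_mul, RCLike.ofReal_mul, RCLike.ofReal_pow,
      ← RCLike.conj_mul]
    ring
  refine ⟨_, div_pos hEpos hNpos, ?_⟩
  rw [RCLike.ofReal_div, ← rayleigh, mul_div_cancel_right₀ _ (RCLike.ofReal_ne_zero.2 hNpos.ne')]

lemma eqOn_zero_of_jordan_chain (B : BeamCoeffs ℓ s k p) {a : ℝ}
    (H : IsClampedSolution ℓ s k (fun x => p x • (a * u x)) u u₁ m t)
    (H' : IsClampedSolution ℓ s k (fun x => p x • (a * v x + u x)) v v₁ n r) :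
    EqOn u 0 (Icc 0 ℓ) := by
  have hℓ := B.pos
  have hp := B.continuousOn_p
  have hu := H.isPrimitive_u.continuousOn hℓ
  have hv := H'.isPrimitive_u.continuousOn hℓ
  have hū : ContinuousOn (fun x => starRingEnd 𝕜 (u x)) (Icc 0 ℓ) :=
    RCLike.continuous_conj.comp_continuousOn hu
  refine eqOn_zero_of_integral_mul_sq_norm_nonpos hℓ hp B.p_pos hu (le_of_eq ?_)
  refine RCLike.ofReal_injective (K := 𝕜) ?_
  rw [← RCLike.intervalIntegral_ofReal, RCLike.ofReal_zero,
    ← sub_eq_zero.2 (H'.integral_mul_comm B H.conj), ← intervalIntegral.integral_sub]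
  · refine intervalIntegral.integral_congr fun x _ => ?_
    simp only [RCLike.real_smul_eq_coe_mul, RCLike.ofReal_pow, ← RCLike.conj_mul, map_mul,
      RCLike.conj_ofReal]
    ring
  · exact (hū.mul (hp.smul ((continuousOn_const.mul hv).add hu))).intervalIntegrable_of_Icc hℓ.le
  · exact (hv.mul (RCLike.continuous_conj.comp_continuousOn
      (hp.smul (continuousOn_const.mul hu)))).intervalIntegrable_of_Icc hℓ.le

end IsClampedSolution

/-! ### Cooperative systems -/

lemma eqOn_zero_of_le_integral {ℓ C : ℝ} {N : ℝ → ℝ} (hN : ContinuousOn N (Icc 0 ℓ))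
    (hN₀ : ∀ x ∈ Icc 0 ℓ, 0 ≤ N x) (h : ∀ x ∈ Icc 0 ℓ, N x ≤ C * ∫ t in 0..x, N t) :
    EqOn N 0 (Icc 0 ℓ) := by
  have hI (x : ℝ) (hx : x ∈ Icc 0 ℓ) :
      HasDerivWithinAt (fun x => ∫ t in 0..x, N t) (N x) (Icc 0 ℓ) x := by
    simpa only [zero_add] using
      (isPrimitive_integral 0 (memLp_of_continuousOn hN)).hasDerivWithinAt hN hx
  have hI₀ : ∀ x ∈ Icc 0 ℓ, ∫ t in 0..x, N t = 0 := by
    refine eq_zero_of_abs_deriv_le_mul_abs_self_of_eq_zero_right (f' := N) (K := C)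
      (fun x hx => (hI x hx).continuousWithinAt)
      (fun x hx => (hI x (Ico_subset_Icc_self hx)).mono_of_mem_nhdsWithin
        (Icc_mem_nhdsGE_of_mem hx)) intervalIntegral.integral_same fun x hx => ?_
    have hx' := Ico_subset_Icc_self hx
    have hpos : 0 ≤ ∫ t in 0..x, N t := intervalIntegral.integral_nonneg hx.1 fun t ht =>
      hN₀ t (Icc_subset_Icc_right hx'.2 ht)
    rw [Real.norm_of_nonneg (hN₀ x hx'), Real.norm_of_nonneg hpos]
    exact h x hx'
  intro x hx
  refine le_antisymm ?_ (hN₀ x hx)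
  simpa only [hI₀ x hx, mul_zero, Pi.zero_apply] using h x hx

lemma eqOn_zero_of_le_integral_right {ℓ C : ℝ} {N : ℝ → ℝ} (hN : ContinuousOn N (Icc 0 ℓ))
    (hN₀ : ∀ x ∈ Icc 0 ℓ, 0 ≤ N x) (h : ∀ x ∈ Icc 0 ℓ, N x ≤ C * ∫ t in x..ℓ, N t) :
    EqOn N 0 (Icc 0 ℓ) := by
  have hmem {x : ℝ} (hx : x ∈ Icc 0 ℓ) : ℓ - x ∈ Icc 0 ℓ :=
    ⟨sub_nonneg.2 hx.2, sub_le_self ℓ hx.1⟩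
  have hrefl : EqOn (fun x => N (ℓ - x)) 0 (Icc 0 ℓ) := by
    refine eqOn_zero_of_le_integral (C := C)
      (hN.comp (continuousOn_const.sub continuousOn_id) fun _ => hmem)
      (fun x hx => hN₀ _ (hmem hx)) fun x hx => ?_
    simpa only [intervalIntegral.integral_comp_sub_left, sub_zero] using h _ (hmem hx)
  intro x hx
  simpa only [sub_sub_cancel, Pi.zero_apply] using hrefl (hmem hx)

section Cooperative

open Matrix

lemma neg_mulVec_le_mulVec_negPart {ι κ : Type*} [Fintype κ] {A : Matrix ι κ ℝ}
    (hA : ∀ i j, 0 ≤ A i j) (y : κ → ℝ) (i : ι) : - (A *ᵥ y) i ≤ (A *ᵥ fun j => (y j)⁻) i := by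
  simp only [mulVec, dotProduct, ← Finset.sum_neg_distrib, ← mul_neg]
  exact Finset.sum_le_sum fun j _ => mul_le_mul_of_nonneg_left (neg_le_negPart _) (hA i j)

variable {ι κ : Type*} [Fintype ι] [Fintype κ]

lemma sum_mulVec_le {A : Matrix ι κ ℝ} (hA : ∀ i j, 0 ≤ A i j) {z : κ → ℝ} (hz : ∀ j, 0 ≤ z j) :
    ∑ i, (A *ᵥ z) i ≤ (∑ i, ∑ j, A i j) * ∑ j, z j := by
  simp only [Finset.sum_mul (s := Finset.univ (α := ι)), Finset.sum_mul (s := Finset.univ (α := κ)),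
    mulVec, dotProduct]
  gcongr with i _ j
  · exact hA i j
  · exact Finset.single_le_sum (fun j _ => hz j) (Finset.mem_univ j)

lemma nonneg_of_eq_add_integral_mulVec {ℓ : ℝ} {A : ℝ → Matrix ι ι ℝ} {y : ℝ → ι → ℝ} {c : ι → ℝ}
    (hA : ∀ i j, ContinuousOn (fun x => A x i j) (Icc 0 ℓ))
    (hA₀ : ∀ x ∈ Icc 0 ℓ, ∀ i j, 0 ≤ A x i j) (hy : ∀ i, ContinuousOn (fun x => y x i) (Icc 0 ℓ))
    (hc : ∀ i, 0 ≤ c i) (h : ∀ x ∈ Icc 0 ℓ, ∀ i, y x i = c i + ∫ t in x..ℓ, (A t *ᵥ y t) i) :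
    ∀ x ∈ Icc 0 ℓ, ∀ i, 0 ≤ y x i := by
  set z : ℝ → ι → ℝ := fun x i => (y x i)⁻
  have hz₀ (x i) : 0 ≤ z x i := negPart_nonneg _
  have hz (i) : ContinuousOn (fun x => z x i) (Icc 0 ℓ) := (hy i).neg.sup continuousOn_const
  have hzsum : ContinuousOn (fun x => ∑ i, z x i) (Icc 0 ℓ) :=
    continuousOn_finsetSum _ fun i _ => hz i
  have hmulVec {f : ℝ → ι → ℝ} (hf : ∀ i, ContinuousOn (fun x => f x i) (Icc 0 ℓ)) (i) :
      ContinuousOn (fun t => (A t *ᵥ f t) i) (Icc 0 ℓ) :=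
    continuousOn_finsetSum _ fun j _ => (hA i j).mul (hf j)
  obtain ⟨C, hC⟩ := isCompact_Icc.exists_bound_of_continuousOn
    (continuousOn_finsetSum Finset.univ fun i _ => continuousOn_finsetSum Finset.univ fun j _ =>
      hA i j)
  have gronwall : ∀ x ∈ Icc 0 ℓ, ∑ i, z x i ≤ C * ∫ t in x..ℓ, ∑ i, z t i := fun x hx => by
    have hs : Icc x ℓ ⊆ Icc 0 ℓ := Icc_subset_Icc_left hx.1
    have hI {f : ℝ → ℝ} (hf : ContinuousOn f (Icc 0 ℓ)) : IntervalIntegrable f volume x ℓ :=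
      (hf.mono hs).intervalIntegrable_of_Icc hx.2
    have hzi (i) : z x i ≤ ∫ t in x..ℓ, (A t *ᵥ z t) i := by
      refine max_le ?_ (intervalIntegral.integral_nonneg hx.2 fun t ht =>
        Finset.sum_nonneg fun j _ => mul_nonneg (hA₀ t (hs ht) i j) (hz₀ t j))
      calc - y x i ≤ ∫ t in x..ℓ, - (A t *ᵥ y t) i := by
            rw [h x hx i, intervalIntegral.integral_neg]
            linarith [hc i]
        _ ≤ _ := intervalIntegral.integral_mono_on hx.2 (hI (hmulVec hy i)).neg (hI (hmulVec hz i))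
          fun t ht => neg_mulVec_le_mulVec_negPart (hA₀ t (hs ht)) (y t) i
    calc ∑ i, z x i ≤ ∑ i, ∫ t in x..ℓ, (A t *ᵥ z t) i := Finset.sum_le_sum fun i _ => hzi i
      _ = ∫ t in x..ℓ, ∑ i, (A t *ᵥ z t) i :=
        (intervalIntegral.integral_finsetSum fun i _ => hI (hmulVec hz i)).symm
      _ ≤ ∫ t in x..ℓ, C * ∑ i, z t i :=
        intervalIntegral.integral_mono_on hx.2
          (hI (continuousOn_finsetSum _ fun i _ => hmulVec hz i)) ((hI hzsum).const_mul C)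
          fun t ht => (sum_mulVec_le (hA₀ t (hs ht)) (hz₀ t)).trans
            (mul_le_mul_of_nonneg_right ((Real.le_norm_self _).trans (hC t (hs ht)))
              (Finset.sum_nonneg fun j _ => hz₀ t j))
      _ = C * ∫ t in x..ℓ, ∑ i, z t i := intervalIntegral.integral_const_mul _ _
  intro x hx i
  have hz_sum := eqOn_zero_of_le_integral_right hzsum
    (fun x _ => Finset.sum_nonneg fun i _ => hz₀ x i) gronwall hx
  exact negPart_eq_zero.1 ((Finset.sum_eq_zero_iff_of_nonneg fun i _ => hz₀ x i).1 hz_sum i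
    (Finset.mem_univ i))

end Cooperative

namespace IsClampedSolution

variable {ℓ a : ℝ} {s k p : ℝ → ℝ}

lemma nonneg (B : BeamCoeffs ℓ s k p) (ha : 0 ≤ a) {u u₁ m t : ℝ → ℝ}
    (H : IsClampedSolution ℓ s k (fun x => p x • (a * u x)) u u₁ m t) (hm : m ℓ = 0)
    (ht : t ℓ ≤ 0) : ∀ x ∈ Icc 0 ℓ, 0 ≤ u x ∧ u₁ x ≤ 0 := by
  have hℓ := B.pos
  -- with alternating signs all entries of the system are nonnegative
  have hnonneg := nonneg_of_eq_add_integral_mulVec (ℓ := ℓ)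
    (A := fun x => !![0, 1, 0, 0; 0, 0, (s x)⁻¹, 0; 0, k x, 0, 1; p x * a, 0, 0, 0])
    (y := fun x => ![u x, - u₁ x, m x, - t x]) (c := ![0, 0, 0, - t ℓ]) ?_ ?_ ?_ ?_ ?_
  · exact fun x hx => ⟨hnonneg x hx 0, by simpa using hnonneg x hx 1⟩
  · have := B.continuousOn_inv_s
    have := B.continuousOn_k
    have : ContinuousOn (fun x => p x * a) (Icc 0 ℓ) := B.continuousOn_p.mul continuousOn_const
    intro i j
    fin_cases i <;> fin_cases j <;> simp [*, continuousOn_const]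
  · intro x hx i j
    have := B.k_nonneg x hx
    have := mul_nonneg (B.p_pos x hx).le ha
    have := (B.s_pos x hx).le
    fin_cases i <;> fin_cases j <;> simp [*]
  · have := H.isPrimitive_u.continuousOn hℓ
    have := H.isPrimitive_u₁.neg.continuousOn hℓ
    have := H.isPrimitive_m.continuousOn hℓ
    have := H.isPrimitive_t.neg.continuousOn hℓ
    intro i
    fin_cases i <;> simpa
  · intro i
    fin_cases i <;> simp [ht]
  · intro x hx i
    have e₁ := H.isPrimitive_u.eq_sub_integral_right hx
    have e₂ := H.isPrimitive_u₁.eq_sub_integral_right hx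
    have e₃ := H.isPrimitive_m.eq_sub_integral_right hx
    have e₄ := H.isPrimitive_t.eq_sub_integral_right hx
    simp only [H.right, H.right_deriv, hm, zero_sub, smul_eq_mul, ← mul_assoc,
      ← intervalIntegral.integral_neg] at e₁ e₂ e₃ e₄
    fin_cases i <;> simp [Matrix.mulVec, dotProduct, Fin.sum_univ_succ, *, sub_eq_neg_add]

lemma eqOn_zero_of_right_real (B : BeamCoeffs ℓ s k p) (ha : 0 ≤ a) {u u₁ m t : ℝ → ℝ}
    (H : IsClampedSolution ℓ s k (fun x => p x • (a * u x)) u u₁ m t) (hm : m ℓ = 0) :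
    EqOn u 0 (Icc 0 ℓ) := by
  wlog ht : t ℓ ≤ 0 generalizing u u₁ m t
  · have H' := H.clm_comp (- ContinuousLinearMap.id ℝ ℝ)
    have hneg : EqOn (fun x => - u x) 0 (Icc 0 ℓ) := this (by simpa using H') (by simpa using hm)
      (by simpa using (not_le.1 ht).le)
    exact fun x hx => neg_eq_zero.1 (hneg hx)
  intro x hx
  refine le_antisymm ?_ (H.nonneg B ha hm ht x hx).1
  rw [H.isPrimitive_u.eq_add_integral x hx, H.left, zero_add, Pi.zero_apply, ← neg_nonneg,
    ← intervalIntegral.integral_neg]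
  exact intervalIntegral.integral_nonneg hx.1 fun y hy =>
    neg_nonneg.2 (H.nonneg B ha hm ht y (Icc_subset_Icc_right hx.2 hy)).2

variable {𝕜 : Type*} [RCLike 𝕜] {u u₁ m t v v₁ n r : ℝ → 𝕜}

lemma eqOn_zero_of_right (B : BeamCoeffs ℓ s k p) (ha : 0 ≤ a)
    (H : IsClampedSolution ℓ s k (fun x => p x • ((a : 𝕜) * u x)) u u₁ m t) (hm : m ℓ = 0) :
    EqOn u 0 (Icc 0 ℓ) := by
  have hre : IsClampedSolution ℓ s k (fun x => p x • (a * RCLike.re (u x)))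
      (fun x => RCLike.re (u x)) (fun x => RCLike.re (u₁ x)) (fun x => RCLike.re (m x))
      (fun x => RCLike.re (t x)) := by
    simpa using H.clm_comp RCLike.reCLM
  have him : IsClampedSolution ℓ s k (fun x => p x • (a * RCLike.im (u x)))
      (fun x => RCLike.im (u x)) (fun x => RCLike.im (u₁ x)) (fun x => RCLike.im (m x))
      (fun x => RCLike.im (t x)) := by
    simpa using H.clm_comp RCLike.imCLM
  intro x hx
  exact RCLike.ext
    (by simpa using hre.eqOn_zero_of_right_real B ha (by simp [hm]) hx)
    (by simpa using him.eqOn_zero_of_right_real B ha (by simp [hm]) hx)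

lemma eqOn_smul_of_eigenvalue (B : BeamCoeffs ℓ s k p) (ha : 0 ≤ a)
    (H : IsClampedSolution ℓ s k (fun x => p x • ((a : 𝕜) * u x)) u u₁ m t) (hm : m ℓ ≠ 0)
    (H' : IsClampedSolution ℓ s k (fun x => p x • ((a : 𝕜) * v x)) v v₁ n r) :
    EqOn v (fun x => n ℓ / m ℓ * u x) (Icc 0 ℓ) := by
  have Hc := H.clm_comp ((n ℓ / m ℓ) • ContinuousLinearMap.id ℝ 𝕜)
  have Hsub := (H'.sub Hc).congr_right (h := fun x => p x • ((a : 𝕜) * (v x - n ℓ / m ℓ * u x)))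
    (.of_forall fun x => ?_)
  · exact fun x hx => sub_eq_zero.1 (Hsub.eqOn_zero_of_right B ha (by simp [hm]) hx)
  · simp only [RCLike.real_smul_eq_coe_mul, smul_apply,
      ContinuousLinearMap.id_apply, smul_eq_mul]
    ring

end IsClampedSolution

/-! ### Operators on Hilbert spaces -/

section HilbertSpace

open ContinuousLinearMap
open scoped BoundedContinuousFunction

variable {𝕜 H : Type*} [RCLike 𝕜] [NormedAddCommGroup H] [InnerProductSpace 𝕜 H]

section Kernel

variable {X : Type*} [TopologicalSpace X] [CompactSpace X]

/-- The operator `w ↦ (x ↦ ⟪κ x, w⟫)`; an integral operator on an `L²` space is of this form when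
its kernel depends continuously, as an element of `L²`, on the free variable. -/
def kernelOperator (κ : C(X, H)) : H →L[𝕜] (X →ᵇ 𝕜) :=
  LinearMap.mkContinuous
    { toFun := fun w => .mkOfCompact
        ⟨fun x => inner 𝕜 (κ x) w, κ.continuous.inner continuous_const⟩
      map_add' := fun w w' => by ext x; simp [inner_add_right]
      map_smul' := fun c w => by ext x; simp [inner_smul_right] } ‖κ‖ fun w => by
    refine (BoundedContinuousFunction.norm_le (by positivity)).2 fun x =>
      (norm_inner_le_norm _ _).trans ?_
    gcongr
    exact κ.norm_coe_le_norm x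

lemma kernelOperator_apply (κ : C(X, H)) (w : H) (x : X) :
    kernelOperator (𝕜 := 𝕜) κ w x = inner 𝕜 (κ x) w := rfl

lemma isCompactOperator_kernelOperator (κ : C(X, H)) :
    IsCompactOperator (kernelOperator (𝕜 := 𝕜) κ) := by
  refine (isCompactOperator_iff_isCompact_closure_image_closedBall
    (kernelOperator (𝕜 := 𝕜) κ : H →ₗ[𝕜] X →ᵇ 𝕜) one_pos).2 ?_
  refine BoundedContinuousFunction.arzela_ascoli (Metric.closedBall 0 ‖kernelOperator (𝕜 := 𝕜) κ‖)
    (isCompact_closedBall _ _) _ ?_ fun x₀ => ?_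
  · rintro _ x ⟨w, hw, rfl⟩
    rw [mem_closedBall_zero_iff] at hw ⊢
    exact (BoundedContinuousFunction.norm_coe_le_norm _ x).trans
      ((kernelOperator (𝕜 := 𝕜) κ).unit_le_opNorm w hw)
  · rw [Metric.equicontinuousAt_iff_right]
    intro ε hε
    filter_upwards [κ.continuous.continuousAt.eventually (Metric.ball_mem_nhds _ hε)] with x hx
    rintro ⟨_, w, hw, rfl⟩
    rw [mem_closedBall_zero_iff] at hw
    calc dist (inner 𝕜 (κ x₀) w) (inner 𝕜 (κ x) w) = ‖inner 𝕜 (κ x - κ x₀) w‖ := by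
          rw [dist_comm, dist_eq_norm, ← inner_sub_left]
      _ ≤ ‖κ x - κ x₀‖ * ‖w‖ := norm_inner_le_norm _ _
      _ ≤ ‖κ x - κ x₀‖ := mul_le_of_le_one_right (norm_nonneg _) hw
      _ < ε := mem_ball_iff_norm.1 hx

end Kernel

/-- The self-adjoint version of the Lax–Milgram theorem on a closed subspace: `T g` is the Galerkin
approximation in `K` of the solution of `N w = g`. -/
lemma exists_isSelfAdjoint_galerkin [CompleteSpace H] {N : H →L[𝕜] H} (hN : IsSelfAdjoint N)
    {c : ℝ} (hc : 0 < c) (hNc : ∀ w, c * ‖w‖ ^ 2 ≤ RCLike.re (inner 𝕜 (N w) w))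
    (K : Submodule 𝕜 H) [CompleteSpace K] :
    ∃ T : H →L[𝕜] H, IsSelfAdjoint T ∧ ∀ g, T g ∈ K ∧ N (T g) - g ∈ Kᗮ := by
  set ι : K →L[𝕜] H := K.subtypeL
  set S : K →L[𝕜] K := adjoint ι ∘L N ∘L ι
  have hS : IsUnit S := isUnit_of_forall_le_norm_inner_map S (c := ⟨c, hc.le⟩) hc fun x => by
    rw [mul_comm, show inner 𝕜 (S x) x = inner 𝕜 (N x) x from adjoint_inner_left ι x _]
    exact (hNc x).trans (RCLike.re_le_norm _)
  have hS_inverse (x : K) : S (Ring.inverse S x) = x :=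
    DFunLike.congr_fun (Ring.mul_inverse_cancel S hS) x
  refine ⟨ι ∘L Ring.inverse S ∘L adjoint ι, (hN.adjoint_conj ι).ringInverse.conj_adjoint ι,
    fun g => ⟨Subtype.coe_prop _, fun v hv => ?_⟩⟩
  have h := congrArg (inner 𝕜 ⟨v, hv⟩) (hS_inverse (adjoint ι g))
  rw [inner_sub_right, sub_eq_zero]
  simp only [S, comp_apply, adjoint_inner_right] at h
  exact h

/-- The constraints `w ⟂ e` and `V w ⟂ e` are accounted for by the Lagrange multipliers `α`, `β`. -/
lemma exists_constrained_solution_operator [CompleteSpace H] {V D K Q : H →L[𝕜] H} (e : H)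
    (hV : IsCompactOperator V) (hD : IsSelfAdjoint D) (hK : IsSelfAdjoint K)
    (hQ : IsSelfAdjoint Q) {c : ℝ} (hc : 0 < c)
    (hDc : ∀ w, c * ‖w‖ ^ 2 ≤ RCLike.re (inner 𝕜 (D w) w))
    (hK₀ : ∀ w, 0 ≤ RCLike.re (inner 𝕜 (K w) w)) :
    ∃ A : H →L[𝕜] H, IsSelfAdjoint A ∧ IsCompactOperator A ∧
      ∀ g, ∃ (w : H) (α β : 𝕜), A g = Q (V (V w)) ∧ inner 𝕜 e w = 0 ∧ inner 𝕜 e (V w) = 0 ∧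
        D w + adjoint V (K (V w)) - adjoint V (adjoint V (Q g)) = α • e + β • adjoint V e := by
  set N : H →L[𝕜] H := D + adjoint V ∘L K ∘L V
  set W : H →L[𝕜] H := Q ∘L V ∘L V
  set U : Submodule 𝕜 H := Submodule.span 𝕜 {e, adjoint V e} with hU
  have hUfin : FiniteDimensional 𝕜 U := .span_of_finite 𝕜 (toFinite _)
  have hNc (w : H) : c * ‖w‖ ^ 2 ≤ RCLike.re (inner 𝕜 (N w) w) := by
    simp only [N, add_apply, comp_apply, inner_add_left, adjoint_inner_left, map_add]
    linarith [hDc w, hK₀ (V w)]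
  obtain ⟨T, hT, hTU⟩ := exists_isSelfAdjoint_galerkin (hD.add (hK.adjoint_conj V)) hc hNc Uᗮ
  refine ⟨W ∘L T ∘L adjoint W, hT.conj_adjoint W, ?_, fun g => ?_⟩
  · exact ((hV.comp_clm V).clm_comp Q).comp_clm (T ∘L adjoint W)
  obtain ⟨hmem, horth⟩ := hTU (adjoint W g)
  have hWg : adjoint W g = adjoint V (adjoint V (Q g)) := by
    simp only [W, adjoint_comp, hQ.adjoint_eq, comp_apply]
  rw [Submodule.orthogonal_orthogonal, hU, Submodule.mem_span_pair, hWg] at horth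
  obtain ⟨α, β, h⟩ := horth
  refine ⟨T (adjoint W g), α, β, rfl, ?_, ?_, by rw [h, hWg]; rfl⟩
  · exact (Submodule.mem_orthogonal U _).1 hmem e (Submodule.subset_span (by simp))
  · rw [← adjoint_inner_left]
    exact (Submodule.mem_orthogonal U _).1 hmem _ (Submodule.subset_span (by simp))

end HilbertSpace

/-! ### Multiplication and integration operators on `L²` -/

section Multiplication

variable {𝕜 X : Type*} [RCLike 𝕜] [MeasurableSpace X] {μ : Measure X} {a : X → ℝ}

/-- Multiplication by an essentially bounded real function `a` on `L²`. -/
def mulOperator (ha : MemLp a ⊤ μ) : Lp 𝕜 2 μ →L[𝕜] Lp 𝕜 2 μ :=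
  (ContinuousLinearMap.mul 𝕜 𝕜).holderL μ ⊤ 2 2 (ha.ofReal.toLp _)

lemma coeFn_mulOperator (ha : MemLp a ⊤ μ) (f : Lp 𝕜 2 μ) :
    mulOperator ha f =ᵐ[μ] fun x => a x • f x := by
  filter_upwards [(ContinuousLinearMap.mul 𝕜 𝕜).coeFn_holder (r := 2)
    (ha.ofReal.toLp _ : Lp 𝕜 ⊤ μ) f, MemLp.coeFn_toLp (ha.ofReal (K := 𝕜))] with x h₁ h₂
  refine h₁.trans ?_
  rw [h₂, ContinuousLinearMap.mul_apply', RCLike.real_smul_eq_coe_mul]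

lemma isSelfAdjoint_mulOperator (ha : MemLp a ⊤ μ) :
    IsSelfAdjoint (mulOperator (𝕜 := 𝕜) ha) := by
  refine ContinuousLinearMap.isSelfAdjoint_iff_isSymmetric.2 fun f g => ?_
  refine integral_congr_ae ?_
  filter_upwards [coeFn_mulOperator ha f, coeFn_mulOperator ha g] with x hf hg
  rw [ContinuousLinearMap.coe_coe, hf, hg, inner_smul_left_eq_smul, inner_smul_right_eq_smul]

lemma mul_sq_norm_le_inner_mulOperator (ha : MemLp a ⊤ μ) {c : ℝ} (hc : ∀ᵐ x ∂μ, c ≤ a x)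
    (f : Lp 𝕜 2 μ) : c * ‖f‖ ^ 2 ≤ RCLike.re (inner 𝕜 (mulOperator ha f) f) := by
  have hnonneg : 0 ≤ RCLike.re (inner 𝕜 (mulOperator ha f - (c : 𝕜) • f) f) := by
    rw [L2.inner_def, ← integral_re (L2.integrable_inner _ _)]
    refine integral_nonneg_of_ae ?_
    filter_upwards [Lp.coeFn_sub (mulOperator ha f) ((c : 𝕜) • f), Lp.coeFn_smul (c : 𝕜) f,
      coeFn_mulOperator ha f, hc] with x h₁ h₂ h₃ hx
    have hx' : inner 𝕜 (a x • f x - (c : 𝕜) • f x) (f x) =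
        (((a x - c) * ‖f x‖ ^ 2 : ℝ) : 𝕜) := by
      rw [inner_sub_left, inner_smul_left, inner_smul_left_eq_smul, inner_self_eq_norm_sq_to_K,
        RCLike.conj_ofReal, RCLike.real_smul_eq_coe_mul]
      push_cast
      ring
    rw [h₁, Pi.sub_apply, h₂, h₃, Pi.smul_apply, hx', RCLike.ofReal_re]
    exact mul_nonneg (sub_nonneg.2 hx) (sq_nonneg _)
  rwa [inner_sub_left, inner_smul_left, inner_self_eq_norm_sq_to_K, RCLike.conj_ofReal, map_sub,
    ← RCLike.ofReal_pow, RCLike.re_ofReal_mul, RCLike.ofReal_re, sub_nonneg] at hnonneg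

end Multiplication

lemma inner_const_one {X 𝕜 : Type*} [RCLike 𝕜] [MeasurableSpace X] {μ : Measure X}
    [IsFiniteMeasure μ] (f : Lp 𝕜 2 μ) : inner 𝕜 (Lp.const 2 μ (1 : 𝕜)) f = ∫ x, f x ∂μ := by
  rw [← indicatorConstLp_univ, L2.inner_indicatorConstLp_one, setIntegral_univ]

/-- The unweighted space `L²(0,ℓ)` of complex functions. -/
abbrev L2Ioo (ℓ : ℝ) : Type := Lp ℂ 2 (volume.restrict (Ioo 0 ℓ))

section Volterra

variable {ℓ : ℝ}

/-- The indicator function of `(0,x)`, as an element of `L²(0,ℓ)` depending on `x`; it is the kernel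
of the Volterra operator. -/
def indicatorIoo (ℓ : ℝ) : C(Icc 0 ℓ, L2Ioo ℓ) where
  toFun x := indicatorConstLp 2 (measurableSet_Ioo (a := 0) (b := (x : ℝ))) (measure_ne_top _ _) 1
  continuous_toFun := by
    refine continuous_indicatorConstLp_set (by norm_num) fun x => ?_
    have hdist : Continuous fun y : Icc 0 ℓ => ENNReal.ofReal |(y : ℝ) - x| :=
      ENNReal.continuous_ofReal.comp (continuous_subtype_val.sub continuous_const).abs
    refine tendsto_of_tendsto_of_tendsto_of_le_of_le tendsto_const_nhds
      (by simpa using hdist.tendsto x) (fun _ => zero_le) fun y => ?_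
    calc _ ≤ volume (symmDiff (Ioo 0 (y : ℝ)) (Ioo 0 (x : ℝ))) := Measure.restrict_apply_le _ _
      _ ≤ volume (uIcc (x : ℝ) y) := measure_mono fun t ht => by
        rw [mem_uIcc]
        simp only [mem_symmDiff, mem_Ioo] at ht
        grind
      _ = _ := Real.volume_interval

lemma kernelOperator_indicatorIoo (f : L2Ioo ℓ) (x : Icc 0 ℓ) :
    kernelOperator (indicatorIoo ℓ) f x = ∫ t in (0 : ℝ)..x, f t := by
  rw [kernelOperator_apply]
  refine (L2.inner_indicatorConstLp_one measurableSet_Ioo (measure_ne_top _ _) f).trans ?_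
  rw [Measure.restrict_restrict measurableSet_Ioo, inter_eq_left.2 (Ioo_subset_Ioo_right x.2.2),
    setIntegral_Ioo_eq_intervalIntegral x.2.1]

/-- The Volterra operator `(V f)(x) = ∫₀ˣ f` on `L²(0,ℓ)`. -/
def volterra (hℓ : 0 < ℓ) : L2Ioo ℓ →L[ℂ] L2Ioo ℓ :=
  BoundedContinuousFunction.toLp 2 _ ℂ ∘L
    BoundedContinuousFunction.compContinuousCLM ℂ ℂ
      (⟨projIcc 0 ℓ hℓ.le, continuous_projIcc⟩ : C(ℝ, Icc 0 ℓ)) ∘L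
    kernelOperator (indicatorIoo ℓ)

lemma isCompactOperator_volterra (hℓ : 0 < ℓ) : IsCompactOperator (volterra hℓ) :=
  ((isCompactOperator_kernelOperator (indicatorIoo ℓ)).clm_comp
    (BoundedContinuousFunction.compContinuousCLM ℂ ℂ _)).clm_comp
    (BoundedContinuousFunction.toLp 2 (volume.restrict (Ioo 0 ℓ)) ℂ)

lemma coeFn_volterra (hℓ : 0 < ℓ) (f : L2Ioo ℓ) :
    volterra hℓ f =ᵐ[volume.restrict (Ioo 0 ℓ)] fun x => ∫ t in 0..x, f t := by
  filter_upwards [BoundedContinuousFunction.coeFn_toLp 2 (volume.restrict (Ioo 0 ℓ)) (𝕜 := ℂ)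
    (BoundedContinuousFunction.compContinuousCLM ℂ ℂ
      (⟨projIcc 0 ℓ hℓ.le, continuous_projIcc⟩ : C(ℝ, Icc 0 ℓ))
      (kernelOperator (indicatorIoo ℓ) f)),
    ae_restrict_mem measurableSet_Ioo] with x hx hx'
  refine hx.trans ?_
  change kernelOperator (indicatorIoo ℓ) f (projIcc 0 ℓ hℓ.le x) = _
  rw [kernelOperator_indicatorIoo, projIcc_of_mem _ (Ioo_subset_Icc_self hx')]

lemma exists_isPrimitive_volterra (hℓ : 0 < ℓ) (f : L2Ioo ℓ) :
    ∃ F : ℝ → ℂ, IsPrimitive ℓ F f ∧ volterra hℓ f =ᵐ[volume.restrict (Ioo 0 ℓ)] F ∧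
      F 0 = 0 ∧ F ℓ = inner ℂ (Lp.const 2 (volume.restrict (Ioo 0 ℓ)) 1) f :=
  ⟨fun x => ∫ t in 0..x, f t, by simpa using isPrimitive_integral 0 (Lp.memLp f),
    coeFn_volterra hℓ f, intervalIntegral.integral_same,
    by rw [inner_const_one, setIntegral_Ioo_eq_intervalIntegral hℓ.le]⟩

lemma adjoint_volterra (hℓ : 0 < ℓ) (f : L2Ioo ℓ) :
    ContinuousLinearMap.adjoint (volterra hℓ) f =
      inner ℂ (Lp.const 2 (volume.restrict (Ioo 0 ℓ)) 1) f • Lp.const 2 _ 1 - volterra hℓ f := by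
  refine ext_inner_left ℂ fun g => ?_
  obtain ⟨F, hF, hVF, hF₀, hFℓ⟩ := exists_isPrimitive_volterra hℓ f
  obtain ⟨G, hG, hVG, -, hGℓ⟩ := exists_isPrimitive_volterra hℓ g
  rw [ContinuousLinearMap.adjoint_inner_right, inner_sub_right, inner_smul_right,
    ← inner_conj_symm g, ← hGℓ, ← hFℓ, L2.inner_def, L2.inner_def]
  have hVGf : ∫ x in Ioo 0 ℓ, inner ℂ (volterra hℓ g x) (f x) =
      ∫ x in (0 : ℝ)..ℓ, starRingEnd ℂ (G x) • f x := by
    rw [← setIntegral_Ioo_eq_intervalIntegral hℓ.le]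
    refine integral_congr_ae (hVG.mono fun x hx => ?_)
    simp only [hx, RCLike.inner_apply', smul_eq_mul]
  have hgVF : ∫ x in Ioo 0 ℓ, inner ℂ (g x) (volterra hℓ f x) =
      ∫ x in (0 : ℝ)..ℓ, starRingEnd ℂ (g x) • F x := by
    rw [← setIntegral_Ioo_eq_intervalIntegral hℓ.le]
    refine integral_congr_ae (hVF.mono fun x hx => ?_)
    simp only [hx, RCLike.inner_apply', smul_eq_mul]
  rw [hVGf, hgVF, eq_sub_iff_add_eq]
  have hparts :=
    (hG.clm_comp Complex.conjCLE.toContinuousLinearMap).integral_smul_add_integral_smul hℓ hF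
  simpa [hF₀, mul_comm] using hparts

lemma exists_isPrimitive_adjoint_volterra (hℓ : 0 < ℓ) (c : ℂ) (f : L2Ioo ℓ) :
    ∃ F : ℝ → ℂ, IsPrimitive ℓ F (fun x => - f x) ∧
      (c • Lp.const 2 _ 1 + ContinuousLinearMap.adjoint (volterra hℓ) f : L2Ioo ℓ)
        =ᵐ[volume.restrict (Ioo 0 ℓ)] F := by
  set d : ℂ := c + inner ℂ (Lp.const 2 (volume.restrict (Ioo 0 ℓ)) 1) f
  obtain ⟨F, hF, hVF, -, -⟩ := exists_isPrimitive_volterra hℓ f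
  refine ⟨fun x => d - F x, ?_, ?_⟩
  · refine ⟨hF.memLp.neg, fun x hx => ?_⟩
    rw [intervalIntegral.integral_neg, hF.eq_add_integral x hx]
    ring
  rw [adjoint_volterra, ← add_sub_assoc, ← add_smul]
  filter_upwards [Lp.coeFn_sub (d • Lp.const 2 (volume.restrict (Ioo 0 ℓ)) (1 : ℂ)) (volterra hℓ f),
    Lp.coeFn_smul d (Lp.const 2 (volume.restrict (Ioo 0 ℓ)) (1 : ℂ)),
    Lp.coeFn_const 2 (volume.restrict (Ioo 0 ℓ)) (1 : ℂ), hVF] with x h₁ h₂ h₃ h₄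
  rw [h₁, Pi.sub_apply, h₂, Pi.smul_apply, h₃, h₄, Function.const_apply, smul_eq_mul, mul_one]

end Volterra

/-! ### Green's operator -/

section Green

variable {ℓ : ℝ} {s k p : ℝ → ℝ}

/-- The weak formulation in terms of `w = u''`: the multiplier `β` is, up to sign, the shear force
at `ℓ`, and `α` is the bending moment there. -/
lemma exists_isClampedSolution_of_volterra (B : BeamCoeffs ℓ s k p)
    (hs : MemLp s ⊤ (volume.restrict (Ioo 0 ℓ))) (hk : MemLp k ⊤ (volume.restrict (Ioo 0 ℓ)))
    {w G : L2Ioo ℓ} {α β : ℂ}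
    (hw : inner ℂ (Lp.const 2 (volume.restrict (Ioo 0 ℓ)) 1) w = 0)
    (hVw : inner ℂ (Lp.const 2 (volume.restrict (Ioo 0 ℓ)) 1) (volterra B.pos w) = 0)
    (h : mulOperator hs w +
        (volterra B.pos).adjoint (mulOperator hk (volterra B.pos w)) -
        (volterra B.pos).adjoint ((volterra B.pos).adjoint G) =
      α • Lp.const 2 _ 1 + β • (volterra B.pos).adjoint (Lp.const 2 _ 1)) :
    ∃ u u₁ m t, IsClampedSolution ℓ s k G u u₁ m t ∧
      volterra B.pos (volterra B.pos w) =ᵐ[volume.restrict (Ioo 0 ℓ)] u := by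
  set V := volterra B.pos
  set Z : L2Ioo ℓ := β • Lp.const 2 _ 1 + V.adjoint G - mulOperator hk (V w) with hZ
  obtain ⟨u₁, hu₁, hVu₁, hu₁0, hu₁ℓ⟩ := exists_isPrimitive_volterra B.pos w
  obtain ⟨u, hu, hVu, hu0, huℓ⟩ := exists_isPrimitive_volterra B.pos (V w)
  obtain ⟨τ, hτ, hVτ⟩ := exists_isPrimitive_adjoint_volterra B.pos β G
  obtain ⟨m, hm, hVm⟩ := exists_isPrimitive_adjoint_volterra B.pos α Z
  have hmoment : mulOperator hs w = α • Lp.const 2 _ 1 + V.adjoint Z := by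
    rw [hZ, map_sub, map_add, map_smul]
    linear_combination (norm := module) h
  refine ⟨u, u₁, m, fun x => - τ x, ⟨hu.congr_right hVu₁, hu₁.congr_right ?_, hm.congr_right ?_,
    hτ.neg.congr_right_of_eqOn fun x _ => neg_neg _, hu0, hu₁0, huℓ.trans hVw, hu₁ℓ.trans hw⟩, hVu⟩
  · filter_upwards [hmoment ▸ hVm, coeFn_mulOperator hs w, ae_restrict_mem measurableSet_Ioo]
      with x h₁ h₂ hx
    rw [← h₁, h₂, inv_smul_smul₀ (B.s_pos x (Ioo_subset_Icc_self hx)).ne']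
  · filter_upwards [Lp.coeFn_sub (β • Lp.const 2 _ 1 + V.adjoint G) (mulOperator hk (V w)), hVτ,
      coeFn_mulOperator hk (V w), hVu₁] with x h₁ h₂ h₃ h₄
    rw [h₁, Pi.sub_apply, h₂, h₃, h₄, neg_sub, sub_eq_neg_add]

/-- `A` is `√p G √p`, where `G` maps `g` to the solution of the clamped problem with right-hand side
`g`; its eigenvalues are the inverses of the eigenvalues of the beam. -/
structure IsGreenOperator (ℓ : ℝ) (s k p : ℝ → ℝ) (A : L2Ioo ℓ →L[ℂ] L2Ioo ℓ) : Prop where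
  isSelfAdjoint : IsSelfAdjoint A
  isCompactOperator : IsCompactOperator A
  exists_isClampedSolution (g : L2Ioo ℓ) :
    ∃ u u₁ m t, IsClampedSolution ℓ s k (fun x => √(p x) • g x) u u₁ m t ∧
      A g =ᵐ[volume.restrict (Ioo 0 ℓ)] fun x => √(p x) • u x

lemma BeamCoeffs.exists_isGreenOperator (B : BeamCoeffs ℓ s k p) :
    ∃ A, IsGreenOperator ℓ s k p A := by
  obtain ⟨x₀, hx₀, hmin⟩ :=
    isCompact_Icc.exists_isMinOn (nonempty_Icc.2 B.pos.le) B.continuousOn_s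
  have hs : MemLp s ⊤ (volume.restrict (Ioo 0 ℓ)) := memLp_of_continuousOn B.continuousOn_s
  have hk : MemLp k ⊤ (volume.restrict (Ioo 0 ℓ)) := memLp_of_continuousOn B.continuousOn_k
  have hr : MemLp (fun x => √(p x)) ⊤ (volume.restrict (Ioo 0 ℓ)) :=
    memLp_of_continuousOn B.continuousOn_p.sqrt
  have hk_nonneg (w : L2Ioo ℓ) : 0 ≤ RCLike.re (inner ℂ (mulOperator hk w) w) := by
    simpa using mul_sq_norm_le_inner_mulOperator hk (ae_restrict_of_forall_mem measurableSet_Ioo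
      fun x hx => B.k_nonneg x (Ioo_subset_Icc_self hx)) w
  obtain ⟨A, hA, hAcompact, hAsol⟩ := exists_constrained_solution_operator (𝕜 := ℂ)
    (Lp.const 2 (volume.restrict (Ioo 0 ℓ)) 1) (isCompactOperator_volterra B.pos)
    (isSelfAdjoint_mulOperator hs) (isSelfAdjoint_mulOperator hk) (isSelfAdjoint_mulOperator hr)
    (B.s_pos x₀ hx₀)
    (mul_sq_norm_le_inner_mulOperator hs (ae_restrict_of_forall_mem measurableSet_Ioo
      fun x hx => hmin (Ioo_subset_Icc_self hx)))
    hk_nonneg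
  refine ⟨A, hA, hAcompact, fun g => ?_⟩
  obtain ⟨w, α, β, hAg, hw, hVw, h⟩ := hAsol g
  obtain ⟨u, u₁, m, t, H, hVVw⟩ := exists_isClampedSolution_of_volterra B hs hk hw hVw h
  refine ⟨u, u₁, m, t, H.congr_right (coeFn_mulOperator hr g), ?_⟩
  filter_upwards [coeFn_mulOperator hr (volterra B.pos (volterra B.pos w)), hVVw] with x h₁ h₂
  rw [hAg, h₁, h₂]

end Green

/-! ### Discrete spectra -/

section Spectrum

open Module.End

variable {𝕜 H : Type*} [RCLike 𝕜] [NormedAddCommGroup H] [InnerProductSpace 𝕜 H] {A : H →L[𝕜] H}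

lemma infinite_setOf_hasEigenvalue [CompleteSpace H] (hA : IsSelfAdjoint A)
    (hc : IsCompactOperator A) (hi : Function.Injective A) (hinf : ¬ FiniteDimensional 𝕜 H) :
    {μ : 𝕜 | HasEigenvalue (A : Module.End 𝕜 H) μ}.Infinite := by
  intro (hfin : Finite {μ : 𝕜 // eigenspace (A : Module.End 𝕜 H) μ ≠ ⊥})
  have heigen (μ : {μ : 𝕜 // eigenspace (A : Module.End 𝕜 H) μ ≠ ⊥}) :
      FiniteDimensional 𝕜 (eigenspace (A : Module.End 𝕜 H) μ) := by
    refine ContinuousLinearMap.finite_dimensional_eigenspace hc _ fun hμ => μ.2 ?_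
    rw [hμ, eigenspace_zero]
    exact LinearMap.ker_eq_bot.2 hi
  have hspan := Submodule.finiteDimensional_iSup
    fun μ : {μ : 𝕜 // eigenspace (A : Module.End 𝕜 H) μ ≠ ⊥} => eigenspace (A : Module.End 𝕜 H) μ
  have htop := ContinuousLinearMap.orthogonalComplement_iSup_eigenspaces_eq_bot hc hA.isSymmetric
  rw [← iSup_ne_bot_subtype, Submodule.orthogonal_eq_bot_iff] at htop
  rw [htop] at hspan
  exact hinf (Module.finite_def.2 ((Submodule.fg_iff_finiteDimensional _).2 hspan))

/-- Unit eigenvectors for distinct eigenvalues are orthogonal, so their images are `ε`-separated. -/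
lemma finite_setOf_hasEigenvalue_le_norm (hA : (A : H →ₗ[𝕜] H).IsSymmetric)
    (hc : IsCompactOperator A) {ε : ℝ} (hε : 0 < ε) :
    {μ : 𝕜 | ε ≤ ‖μ‖ ∧ HasEigenvalue (A : Module.End 𝕜 H) μ}.Finite := by
  by_contra hinf
  let μ := Set.Infinite.natEmbedding _ hinf
  have hunit (n : ℕ) : ∃ v : H, ‖v‖ = 1 ∧ A v = (μ n : 𝕜) • v := by
    obtain ⟨v, hv⟩ := (μ n).2.2.exists_hasEigenvector
    refine ⟨((‖v‖⁻¹ : ℝ) : 𝕜) • v, ?_, ?_⟩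
    · rw [RCLike.ofReal_inv, norm_smul_inv_norm hv.2]
    · rw [map_smul, smul_comm]
      exact congrArg _ hv.apply_eq_smul
  choose v hv hAv using hunit
  have horth {i j : ℕ} (hij : i ≠ j) : inner 𝕜 (v i) (v j) = 0 :=
    hA.orthogonalFamily_eigenspaces (Subtype.coe_ne_coe.2 (μ.injective.ne hij))
      ⟨v i, mem_eigenspace_iff.2 (hAv i)⟩ ⟨v j, mem_eigenspace_iff.2 (hAv j)⟩
  have hsep {i j : ℕ} (hij : i ≠ j) : ε ≤ dist (A (v i)) (A (v j)) := by
    calc ε ≤ ‖(μ i : 𝕜)‖ := (μ i).2.1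
      _ = ‖inner 𝕜 (v i) (A (v i) - A (v j))‖ := by
        rw [hAv, hAv, inner_sub_right, inner_smul_right, inner_smul_right, horth hij,
          inner_self_eq_norm_sq_to_K, hv]
        simp
      _ ≤ ‖v i‖ * ‖A (v i) - A (v j)‖ := norm_inner_le_norm _ _
      _ = dist (A (v i)) (A (v j)) := by rw [hv, one_mul, dist_eq_norm]
  have hK := hc.isCompact_closure_image_closedBall (f := (A : H →ₗ[𝕜] H)) 1
  obtain ⟨x, -, φ, hφ, hx⟩ := hK.tendsto_subseq (x := fun n => A (v n)) fun n =>
    subset_closure ⟨v n, by simp [hv], rfl⟩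
  obtain ⟨N, hN⟩ := Metric.cauchySeq_iff'.1 hx.cauchySeq ε hε
  exact (hN (N + 1) N.le_succ).not_ge (hsep (hφ N.lt_succ_self).ne')

end Spectrum

lemma exists_strictMono_range_eq {α : Type*} [LinearOrder α] {S : Set α} (hinf : S.Infinite)
    (hfin : ∀ b, (S ∩ Iic b).Finite) :
    ∃ e : ℕ → α, StrictMono e ∧ range e = S ∧ Filter.Tendsto e Filter.atTop Filter.atTop := by
  obtain ⟨b, hb⟩ := hinf.nonempty
  obtain ⟨a, ha, hmin⟩ := (S ∩ Iic b).exists_min_image id (hfin b) ⟨b, hb, le_rfl⟩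
  let _ : OrderBot S :=
    { bot := ⟨a, ha.1⟩
      bot_le := fun x => (le_total (x : α) b).elim (fun hx => hmin x ⟨x.2, hx⟩) ha.2.trans }
  let _ : LocallyFiniteOrder S := .ofFiniteIcc fun x y =>
    ((hfin y).preimage Subtype.val_injective.injOn).subset fun z hz => ⟨z.2, hz.2⟩
  let _ : SuccOrder S := LinearLocallyFiniteOrder.succOrder S
  let _ : PredOrder S := LinearLocallyFiniteOrder.predOrder S
  have hnext : NoMaxOrder S := ⟨fun x => by
    obtain ⟨y, hy, hxy⟩ := (hinf.sdiff (hfin x)).nonempty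
    exact ⟨⟨y, hy⟩, not_le.1 fun h => hxy ⟨hy, h⟩⟩⟩
  have : Nonempty S := ⟨⟨b, hb⟩⟩
  let e : ℕ ≃o S := (orderIsoNatOfLinearSuccPredArch (ι := S)).symm
  refine ⟨fun n => e n, Subtype.strictMono_coe _ |>.comp e.strictMono, ?_, ?_⟩
  · rw [range_comp' Subtype.val e, e.surjective.range_eq, image_univ, Subtype.range_coe]
  · refine Filter.tendsto_atTop_atTop_of_monotone (fun i j h => e.monotone h) fun c => ?_
    obtain ⟨y, hy, hcy⟩ := (hinf.sdiff (hfin c)).nonempty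
    exact ⟨e.symm ⟨y, hy⟩, by simpa using (not_le.1 fun h => hcy ⟨hy, h⟩).le⟩

lemma not_finiteDimensional_Lp_two {X 𝕜 : Type*} [RCLike 𝕜] [MeasurableSpace X] {μ : Measure X}
    [IsFiniteMeasure μ] {S : ℕ → Set X} (hS : ∀ n, MeasurableSet (S n))
    (hdisj : Pairwise (Function.onFun Disjoint S)) (hpos : ∀ n, μ (S n) ≠ 0) :
    ¬ FiniteDimensional 𝕜 (Lp 𝕜 2 μ) := by
  intro hfin
  let v : ℕ → Lp 𝕜 2 μ := fun n => indicatorConstLp 2 (hS n) (measure_ne_top μ _) (1 : 𝕜)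
  have hv (i j : ℕ) : inner 𝕜 (v i) (v j) = (μ.real (S i ∩ S j) : 𝕜) :=
    L2.inner_indicatorConstLp_one_indicatorConstLp_one _ _ _ _
  have hli : LinearIndependent 𝕜 v := by
    refine linearIndependent_of_ne_zero_of_inner_eq_zero (fun n hn => hpos n ?_) fun i j hij => ?_
    · simpa [hn, measureReal_eq_zero_iff] using (hv n n).symm
    · dsimp only
      rw [hv, (hdisj hij).inter_eq, measureReal_empty, RCLike.ofReal_zero]
  exact not_finite_iff_infinite.2 (inferInstance : Infinite ℕ) hli.finite

lemma not_finiteDimensional_L2Ioo {ℓ : ℝ} (hℓ : 0 < ℓ) : ¬ FiniteDimensional ℂ (L2Ioo ℓ) := by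
  let a : ℕ → ℝ := fun n => ℓ / (n + 1)
  have ha : StrictAnti a := fun i j hij => by
    have : (i : ℝ) < j := by exact_mod_cast hij
    simp only [a]
    gcongr
  refine not_finiteDimensional_Lp_two (S := fun n => Ioo (a (n + 1)) (a n))
    (fun _ => measurableSet_Ioo) ?_ fun n => ?_
  · exact ha.antitone.pairwise_disjoint_on_Ioo_succ
  · have hℓn : a n ≤ ℓ := by simpa [a] using ha.antitone n.zero_le
    have h0n : 0 ≤ a (n + 1) := by positivity
    rw [Measure.restrict_apply measurableSet_Ioo, inter_eq_left.2 (Ioo_subset_Ioo h0n hℓn),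
      Real.volume_Ioo, ne_eq, ENNReal.ofReal_eq_zero, not_le, sub_pos]
    exact ha n.lt_succ_self

section Eigenvalues

open Module.End

variable {ℓ : ℝ} {s k p : ℝ → ℝ}

/-- The eigenvalues of the clamped beam, read off from the first order system; they are all real
by `IsClampedSolution.exists_pos_eq_ofReal`. -/
def beamEigenvalues (ℓ : ℝ) (s k p : ℝ → ℝ) : Set ℝ :=
  {a | ∃ u u₁ m t : ℝ → ℂ, IsClampedSolution ℓ s k (fun x => p x • ((a : ℂ) * u x)) u u₁ m t ∧
    ∃ x ∈ Icc 0 ℓ, u x ≠ 0}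

lemma BeamCoeffs.pos_of_mem_beamEigenvalues (B : BeamCoeffs ℓ s k p) {a : ℝ}
    (ha : a ∈ beamEigenvalues ℓ s k p) : 0 < a := by
  obtain ⟨u, u₁, m, t, H, hu⟩ := ha
  obtain ⟨b, hb, hab⟩ := H.exists_pos_eq_ofReal B hu
  exact Complex.ofReal_injective hab ▸ hb

lemma IsClampedSolution.ae_eq_zero_of_eqOn_zero {E : Type*} [NormedAddCommGroup E]
    [NormedSpace ℝ E] [CompleteSpace E] {g u u₁ m t : ℝ → E} (B : BeamCoeffs ℓ s k p)
    (H : IsClampedSolution ℓ s k g u u₁ m t) (hu : EqOn u 0 (Icc 0 ℓ)) :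
    g =ᵐ[volume.restrict (Ioo 0 ℓ)] 0 := by
  have hu₁ : EqOn u₁ 0 (Icc 0 ℓ) :=
    eqOn_Icc_of_ae_eq B.pos (H.isPrimitive_u₁.continuousOn B.pos) continuousOn_const
      (H.isPrimitive_u.ae_eq_zero B.pos hu)
  have hm : EqOn m 0 (Icc 0 ℓ) := by
    refine eqOn_Icc_of_ae_eq B.pos (H.isPrimitive_m.continuousOn B.pos) continuousOn_const ?_
    filter_upwards [H.isPrimitive_u₁.ae_eq_zero B.pos hu₁, ae_restrict_mem measurableSet_Ioo]
      with x hx hx'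
    exact (smul_eq_zero.1 hx).resolve_left (inv_ne_zero (B.s_pos x (Ioo_subset_Icc_self hx')).ne')
  have ht : EqOn t 0 (Icc 0 ℓ) := by
    refine eqOn_Icc_of_ae_eq B.pos (H.isPrimitive_t.continuousOn B.pos) continuousOn_const ?_
    filter_upwards [H.isPrimitive_m.ae_eq_zero B.pos hm, ae_restrict_mem measurableSet_Ioo]
      with x hx hx'
    simpa only [hu₁ (Ioo_subset_Icc_self hx'), Pi.zero_apply, smul_zero, add_zero] using hx
  exact H.isPrimitive_t.ae_eq_zero B.pos ht

namespace IsGreenOperator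

variable {A : L2Ioo ℓ →L[ℂ] L2Ioo ℓ}

lemma injective (B : BeamCoeffs ℓ s k p) (hA : IsGreenOperator ℓ s k p A) :
    Function.Injective A := by
  refine (injective_iff_map_eq_zero A).2 fun g hg => ?_
  obtain ⟨u, u₁, m, t, H, hAg⟩ := hA.exists_isClampedSolution g
  have hp {x : ℝ} (hx : x ∈ Ioo 0 ℓ) : √(p x) ≠ 0 :=
    (Real.sqrt_pos.2 (B.p_pos x (Ioo_subset_Icc_self hx))).ne'
  have hu : EqOn u 0 (Icc 0 ℓ) := by
    refine eqOn_Icc_of_ae_eq B.pos (H.isPrimitive_u.continuousOn B.pos) continuousOn_const ?_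
    filter_upwards [hg ▸ hAg, Lp.coeFn_zero ℂ 2 (volume.restrict (Ioo 0 ℓ)),
      ae_restrict_mem measurableSet_Ioo] with x h₁ h₂ hx
    exact (smul_eq_zero.1 (h₁.symm.trans h₂)).resolve_left (hp hx)
  refine (Lp.eq_zero_iff_ae_eq_zero).2 ?_
  filter_upwards [H.ae_eq_zero_of_eqOn_zero B hu, ae_restrict_mem measurableSet_Ioo] with x hgx hx
  exact (smul_eq_zero.1 hgx).resolve_left (hp hx)

lemma exists_mem_beamEigenvalues (B : BeamCoeffs ℓ s k p) (hA : IsGreenOperator ℓ s k p A) {μ : ℂ}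
    (hμ : HasEigenvalue (A : Module.End ℂ (L2Ioo ℓ)) μ) :
    ∃ a ∈ beamEigenvalues ℓ s k p, ((a : ℂ))⁻¹ = μ := by
  obtain ⟨g, hg⟩ := hμ.exists_hasEigenvector
  have hAg : A g = μ • g := hg.apply_eq_smul
  have hμ₀ : μ ≠ 0 := by
    rintro rfl
    exact hg.2 (hA.injective B (by rw [hAg, zero_smul, map_zero]))
  obtain ⟨u, u₁, m, t, H, hu⟩ := hA.exists_isClampedSolution g
  have hgu : ∀ᵐ x ∂volume.restrict (Ioo 0 ℓ), μ * g x = √(p x) • u x := by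
    filter_upwards [hAg ▸ hu, Lp.coeFn_smul μ g] with x h₁ h₂
    rw [← h₁, h₂, Pi.smul_apply, smul_eq_mul]
  have H' : IsClampedSolution ℓ s k (fun x => p x • (μ⁻¹ * u x)) u u₁ m t := by
    refine H.congr_right ?_
    filter_upwards [hgu, ae_restrict_mem measurableSet_Ioo] with x h₁ hx
    calc √(p x) • g x = √(p x) • (μ⁻¹ * (μ * g x)) := by rw [inv_mul_cancel_left₀ hμ₀]
      _ = p x • (μ⁻¹ * u x) := by
        rw [h₁, mul_smul_comm, smul_smul,
          Real.mul_self_sqrt (B.p_pos x (Ioo_subset_Icc_self hx)).le]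
  have hne : ∃ x ∈ Icc 0 ℓ, u x ≠ 0 := by
    by_contra! hu₀
    refine hg.2 (Lp.eq_zero_iff_ae_eq_zero.2 ?_)
    filter_upwards [hgu, ae_restrict_mem measurableSet_Ioo] with x h₁ hx
    rw [hu₀ x (Ioo_subset_Icc_self hx), smul_zero] at h₁
    exact (mul_eq_zero.1 h₁).resolve_left hμ₀
  obtain ⟨a, -, ha⟩ := H'.exists_pos_eq_ofReal B hne
  rw [ha] at H'
  exact ⟨a, ⟨u, u₁, m, t, H', hne⟩, inv_eq_iff_eq_inv.2 ha.symm⟩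

lemma hasEigenvalue_inv (B : BeamCoeffs ℓ s k p) (hA : IsGreenOperator ℓ s k p A) {a : ℝ}
    (ha : a ∈ beamEigenvalues ℓ s k p) :
    HasEigenvalue (A : Module.End ℂ (L2Ioo ℓ)) (a : ℂ)⁻¹ := by
  have ha₀ : (a : ℂ) ≠ 0 := Complex.ofReal_ne_zero.2 (B.pos_of_mem_beamEigenvalues ha).ne'
  obtain ⟨u, u₁, m, t, H, x, hx, hux⟩ := ha
  have hc : ContinuousOn (fun x => √(p x) • u x) (Icc 0 ℓ) :=
    B.continuousOn_p.sqrt.smul (H.isPrimitive_u.continuousOn B.pos)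
  set g : L2Ioo ℓ := (memLp_of_continuousOn (p := 2) hc).toLp _
  have hg : g =ᵐ[volume.restrict (Ioo 0 ℓ)] fun x => √(p x) • u x := MemLp.coeFn_toLp _
  obtain ⟨v, v₁, n, r, H', hAg⟩ := hA.exists_isClampedSolution g
  have huv : EqOn (fun x => (a : ℂ)⁻¹ * u x) v (Icc 0 ℓ) := by
    refine (H.clm_comp (ContinuousLinearMap.mul ℝ ℂ (a : ℂ)⁻¹)).eqOn B H' ?_
    filter_upwards [hg, ae_restrict_mem measurableSet_Ioo] with x h₁ hx
    rw [h₁, smul_smul, Real.mul_self_sqrt (B.p_pos x (Ioo_subset_Icc_self hx)).le, map_smul,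
      ContinuousLinearMap.mul_apply', inv_mul_cancel_left₀ ha₀]
  refine hasEigenvalue_of_hasEigenvector (x := g) ⟨mem_eigenspace_iff.2 (Lp.ext ?_), fun hg₀ => ?_⟩
  · filter_upwards [hAg, hg, Lp.coeFn_smul (a : ℂ)⁻¹ g, ae_restrict_mem measurableSet_Ioo]
      with x h₁ h₂ h₃ hx
    rw [h₃, Pi.smul_apply, h₂, smul_eq_mul, mul_smul_comm]
    exact h₁.trans (congrArg _ (huv (Ioo_subset_Icc_self hx)).symm)
  · refine smul_ne_zero (Real.sqrt_pos.2 (B.p_pos x hx)).ne' hux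
      (eqOn_Icc_of_ae_eq B.pos hc continuousOn_const (hg.symm.trans ?_) hx)
    exact hg₀ ▸ Lp.coeFn_zero ℂ 2 _

end IsGreenOperator

namespace BeamCoeffs

lemma infinite_beamEigenvalues (B : BeamCoeffs ℓ s k p) : (beamEigenvalues ℓ s k p).Infinite := by
  obtain ⟨A, hA⟩ := B.exists_isGreenOperator
  intro hfin
  exact infinite_setOf_hasEigenvalue hA.isSelfAdjoint hA.isCompactOperator (hA.injective B)
    (not_finiteDimensional_L2Ioo B.pos)
    ((hfin.image _).subset fun μ hμ => hA.exists_mem_beamEigenvalues B hμ)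

lemma finite_beamEigenvalues_inter_Iic (B : BeamCoeffs ℓ s k p) (b : ℝ) :
    (beamEigenvalues ℓ s k p ∩ Iic b).Finite := by
  obtain ⟨A, hA⟩ := B.exists_isGreenOperator
  have hfin := finite_setOf_hasEigenvalue_le_norm hA.isSelfAdjoint.isSymmetric
    hA.isCompactOperator (ε := (max b 1)⁻¹) (by positivity)
  refine (hfin.preimage (f := fun a : ℝ => (a : ℂ)⁻¹)
    (inv_injective.comp Complex.ofReal_injective).injOn).subset fun a ⟨ha, hab⟩ =>
      ⟨?_, hA.hasEigenvalue_inv B ha⟩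
  have ha₀ := B.pos_of_mem_beamEigenvalues ha
  rw [norm_inv, Complex.norm_of_nonneg ha₀.le]
  exact inv_anti₀ ha₀ (hab.trans (le_max_left _ _))

end BeamCoeffs

end Eigenvalues

section Operator

variable {ℓ : ℝ} {σ q ρ s k p : ℝ → ℝ}

lemma IsEigenfunction.exists_isClampedSolution (R : IsRepresentative ℓ σ q ρ s k p) {z : ℂ}
    {u : ℝ → ℂ} (h : IsEigenfunction ℓ σ q ρ z u) :
    ∃ u₁ m t, IsClampedSolution ℓ s k (fun x => p x • (z * u x)) u u₁ m t := by
  obtain ⟨u₁, m, t, H⟩ := h.1.exists_isClampedSolution R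
  refine ⟨u₁, m, t, H.congr_right ?_⟩
  filter_upwards [R.p_ae_eq] with x hx
  rw [hx, Complex.real_smul, mul_left_comm, mul_assoc]

lemma isEigenvalue_iff (R : IsRepresentative ℓ σ q ρ s k p) {z : ℂ} :
    IsEigenvalue ℓ σ q ρ z ↔ ∃ a ∈ beamEigenvalues ℓ s k p, z = (a : ℂ) := by
  constructor
  · rintro ⟨u, hu⟩
    obtain ⟨u₁, m, t, H⟩ := hu.exists_isClampedSolution R
    obtain ⟨a, -, rfl⟩ := H.exists_pos_eq_ofReal R.toBeamCoeffs hu.2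
    exact ⟨a, ⟨u, u₁, m, t, H, hu.2⟩, rfl⟩
  · rintro ⟨a, ⟨u, u₁, m, t, H, hu⟩, rfl⟩
    refine ⟨u, (H.congr_right ?_).solvesClamped R, hu⟩
    filter_upwards [R.p_ae_eq] with x hx
    rw [hx, Complex.real_smul, mul_left_comm, mul_assoc]

lemma IsEigenfunction.iteratedDerivWithin_two_ne_zero (R : IsRepresentative ℓ σ q ρ s k p) {a : ℝ}
    (ha : 0 ≤ a) {u : ℝ → ℂ} (h : IsEigenfunction ℓ σ q ρ a u) :
    iteratedDerivWithin 2 u (Icc 0 ℓ) ℓ ≠ 0 := by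
  have hℓ : ℓ ∈ Icc 0 ℓ := right_mem_Icc.2 R.pos.le
  obtain ⟨u₁, m, t, H⟩ := h.exists_isClampedSolution R
  obtain ⟨x, hx, hux⟩ := h.2
  rw [H.eqOn_iteratedDerivWithin_two R.toBeamCoeffs hℓ]
  exact smul_ne_zero (inv_ne_zero (R.s_pos ℓ hℓ).ne')
    fun hm => hux (H.eqOn_zero_of_right R.toBeamCoeffs ha hm hx)

lemma ae_weight (R : IsRepresentative ℓ σ q ρ s k p) :
    ae (weight ℓ ρ) = ae (volume.restrict (Ioo 0 ℓ)) := by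
  refine le_antisymm (withDensity_absolutelyContinuous _ _).ae_le
    (withDensity_absolutelyContinuous' ?_ ?_).ae_le
  · have hp : AEMeasurable p (volume.restrict (Ioo 0 ℓ)) :=
      (R.continuousOn_p.mono Ioo_subset_Icc_self).aemeasurable measurableSet_Ioo
    exact (hp.congr R.p_ae_eq.symm).ennreal_ofReal
  · filter_upwards [R.p_ae_eq, ae_restrict_mem measurableSet_Ioo] with x hρp hx
    rw [hρp, Ne, ENNReal.ofReal_eq_zero, not_le]
    exact R.p_pos x (Ioo_subset_Icc_self hx)

lemma ae_eq_weight_iff (R : IsRepresentative ℓ σ q ρ s k p) {α : Type*} {f g : ℝ → α} :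
    f =ᵐ[weight ℓ ρ] g ↔ f =ᵐ[volume.restrict (Ioo 0 ℓ)] g := by
  rw [Filter.EventuallyEq, ae_weight R, Filter.EventuallyEq]

lemma memLp_weight (R : IsRepresentative ℓ σ q ρ s k p) {u : ℝ → ℂ}
    (hu : ContinuousOn u (Icc 0 ℓ)) : MemLp u 2 (weight ℓ ρ) := by
  have hp : Integrable p (volume.restrict (Ioo 0 ℓ)) :=
    R.continuousOn_p.integrableOn_Icc.mono_set Ioo_subset_Icc_self
  have : IsFiniteMeasure (weight ℓ ρ) :=
    isFiniteMeasure_withDensity_ofReal (hp.congr R.p_ae_eq.symm).hasFiniteIntegral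
  obtain ⟨C, hC⟩ := isCompact_Icc.exists_bound_of_continuousOn hu
  refine MemLp.of_bound (((hu.mono Ioo_subset_Icc_self).aestronglyMeasurable
    measurableSet_Ioo).mono_ac (withDensity_absolutelyContinuous _ _)) C ?_
  rw [ae_weight R]
  exact ae_restrict_of_forall_mem measurableSet_Ioo fun x hx => hC x (Ioo_subset_Icc_self hx)

lemma mem_opGraph_iff (R : IsRepresentative ℓ σ q ρ s k p) {y w : L2w ℓ ρ} :
    (y, w) ∈ opGraph R.pos σ q ρ ↔ ∃ u u₁ m t, y =ᵐ[volume.restrict (Ioo 0 ℓ)] u ∧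
      IsClampedSolution ℓ s k (fun x => p x • w x) u u₁ m t := by
  constructor
  · rintro ⟨u, f, hyu, hwf, h⟩
    obtain ⟨u₁, m, t, H⟩ := h.exists_isClampedSolution R
    refine ⟨u, u₁, m, t, (ae_eq_weight_iff R).1 hyu, H.congr_right ?_⟩
    filter_upwards [(ae_eq_weight_iff R).1 hwf, R.p_ae_eq] with x hwf hρp
    rw [hρp, ← hwf, Complex.real_smul]
  · rintro ⟨u, u₁, m, t, hyu, H⟩
    refine ⟨u, w, (ae_eq_weight_iff R).2 hyu, Filter.EventuallyEq.rfl,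
      (H.congr_right ?_).solvesClamped R⟩
    filter_upwards [R.p_ae_eq] with x hρp
    rw [hρp, Complex.real_smul]

lemma mem_rootSpace_succ (R : IsRepresentative ℓ σ q ρ s k p) {z : ℂ} {j : ℕ} {y : L2w ℓ ρ} :
    y ∈ rootSpace R.pos σ q ρ z (j + 1) ↔ ∃ w ∈ rootSpace R.pos σ q ρ z j, ∃ u u₁ m t,
      y =ᵐ[volume.restrict (Ioo 0 ℓ)] u ∧
      IsClampedSolution ℓ s k (fun x => p x • (z * u x + w x)) u u₁ m t := by
  refine exists_congr fun w => and_congr_right fun _ => (mem_opGraph_iff R).trans ?_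
  refine exists_congr fun u => exists_congr fun u₁ => exists_congr fun m => exists_congr fun t =>
    and_congr_right fun hyu => ?_
  have hzw : (z • y + w : L2w ℓ ρ) =ᵐ[volume.restrict (Ioo 0 ℓ)] fun x => z * u x + w x := by
    filter_upwards [(ae_eq_weight_iff R).1 (Lp.coeFn_add (z • y) w),
      (ae_eq_weight_iff R).1 (Lp.coeFn_smul z y), hyu] with x hadd hsmul hyu
    rw [hadd, Pi.add_apply, hsmul, Pi.smul_apply, hyu, smul_eq_mul]
  have hp : (fun x => p x • (z • y + w : L2w ℓ ρ) x) =ᵐ[volume.restrict (Ioo 0 ℓ)]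
      fun x => p x • (z * u x + w x) := by
    filter_upwards [hzw] with x hx
    rw [hx]
  exact ⟨fun H => H.congr_right hp, fun H => H.congr_right hp.symm⟩

lemma mem_eigenSpace (R : IsRepresentative ℓ σ q ρ s k p) {z : ℂ} {y : L2w ℓ ρ} :
    y ∈ eigenSpace R.pos σ q ρ z ↔ ∃ u u₁ m t, y =ᵐ[volume.restrict (Ioo 0 ℓ)] u ∧
      IsClampedSolution ℓ s k (fun x => p x • (z * u x)) u u₁ m t := by
  have hp (u : ℝ → ℂ) : (fun x => p x • (z * u x + (0 : L2w ℓ ρ) x))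
      =ᵐ[volume.restrict (Ioo 0 ℓ)] fun x => p x • (z * u x) := by
    filter_upwards [(ae_eq_weight_iff R).1 (Lp.coeFn_zero ℂ 2 (weight ℓ ρ))] with x hx
    rw [hx, Pi.zero_apply, add_zero]
  rw [eigenSpace, mem_rootSpace_succ R]
  constructor
  · rintro ⟨w, hw, u, u₁, m, t, hyu, H⟩
    obtain rfl : w = 0 := (Submodule.mem_bot ℂ).1 hw
    exact ⟨u, u₁, m, t, hyu, H.congr_right (hp u)⟩
  · rintro ⟨u, u₁, m, t, hyu, H⟩
    exact ⟨0, zero_mem _, u, u₁, m, t, hyu, H.congr_right (hp u).symm⟩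

lemma finrank_eigenSpace (R : IsRepresentative ℓ σ q ρ s k p) {a : ℝ}
    (ha : a ∈ beamEigenvalues ℓ s k p) :
    Module.finrank ℂ (eigenSpace R.pos σ q ρ (a : ℂ)) = 1 := by
  have B := R.toBeamCoeffs
  have ha₀ := (B.pos_of_mem_beamEigenvalues ha).le
  obtain ⟨u, u₁, m, t, H, x, hx, hux⟩ := ha
  have hm : m ℓ ≠ 0 := fun hm => hux (H.eqOn_zero_of_right B ha₀ hm hx)
  have hu := H.isPrimitive_u.continuousOn B.pos
  set y : L2w ℓ ρ := (memLp_weight R hu).toLp u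
  have hyu : y =ᵐ[volume.restrict (Ioo 0 ℓ)] u := (ae_eq_weight_iff R).1 (MemLp.coeFn_toLp _)
  have hy : y ≠ 0 := fun hy => hux <| eqOn_Icc_of_ae_eq B.pos hu continuousOn_const
    (hyu.symm.trans (hy ▸ (ae_eq_weight_iff R).1 (Lp.coeFn_zero ℂ 2 _))) hx
  refine finrank_eq_one (⟨y, (mem_eigenSpace R).2 ⟨u, u₁, m, t, hyu, H⟩⟩ :
    eigenSpace R.pos σ q ρ (a : ℂ)) (fun h => hy (congrArg Subtype.val h)) fun ⟨y', hy'⟩ => ?_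
  obtain ⟨v, v₁, n, r, hyv, H'⟩ := (mem_eigenSpace R).1 hy'
  refine ⟨n ℓ / m ℓ, Subtype.ext (Lp.ext ((ae_eq_weight_iff R).2 ?_))⟩
  filter_upwards [(ae_eq_weight_iff R).1 (Lp.coeFn_smul (n ℓ / m ℓ) y), hyu, hyv,
    ae_restrict_mem measurableSet_Ioo] with x hsmul hyu hyv hx
  refine hsmul.trans ?_
  rw [Pi.smul_apply, hyu, hyv, smul_eq_mul]
  exact (H.eqOn_smul_of_eigenvalue B ha₀ hm H' (Ioo_subset_Icc_self hx)).symm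

lemma rootSpace_le_eigenSpace (R : IsRepresentative ℓ σ q ρ s k p) (a : ℝ) (j : ℕ) :
    rootSpace R.pos σ q ρ (a : ℂ) j ≤ eigenSpace R.pos σ q ρ (a : ℂ) := by
  induction j with
  | zero => exact bot_le
  | succ j ih =>
    intro y hy
    obtain ⟨w, hw, v, v₁, n, r, hyv, H'⟩ := (mem_rootSpace_succ R).1 hy
    obtain ⟨u, u₁, m, t, hwu, H⟩ := (mem_eigenSpace R).1 (ih hw)
    have Hchain : IsClampedSolution ℓ s k (fun x => p x • (a * v x + u x)) v v₁ n r :=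
      H'.congr_right (by filter_upwards [hwu] with x hx; rw [hx])
    have hu : EqOn u 0 (Icc 0 ℓ) := H.eqOn_zero_of_jordan_chain R.toBeamCoeffs Hchain
    refine (mem_eigenSpace R).2 ⟨v, v₁, n, r, hyv, Hchain.congr_right ?_⟩
    filter_upwards [ae_restrict_mem measurableSet_Ioo] with x hx
    rw [hu (Ioo_subset_Icc_self hx), Pi.zero_apply, add_zero]

lemma genEigenSpace_eq_eigenSpace (R : IsRepresentative ℓ σ q ρ s k p) (a : ℝ) :
    genEigenSpace R.pos σ q ρ (a : ℂ) = eigenSpace R.pos σ q ρ (a : ℂ) :=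
  le_antisymm (iSup_le (rootSpace_le_eigenSpace R a))
    (le_iSup (rootSpace R.pos σ q ρ (a : ℂ)) 1)

end Operator

end ClampedBeam

end

open ClampedBeam in
theorem theorem3p1_general (ℓ : ℝ) (hℓ : 0 < ℓ) (σ q ρ : ℝ → ℝ)
    (hρH : MemH ℓ 1 ρ) (hσH : MemH ℓ 2 σ) (hqH : MemH ℓ 1 q)
    (ρ₀ σ₀ : ℝ) (hρ₀ : 0 < ρ₀) (hσ₀ : 0 < σ₀)
    (hρ : ∀ x ∈ Icc 0 ℓ, ρ₀ ≤ ρ x) (hσ : ∀ x ∈ Icc 0 ℓ, σ₀ ≤ σ x) (hq : ∀ x ∈ Icc 0 ℓ, 0 ≤ q x) :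
    ∃ eig : ℕ → ℝ,
      (∀ z : ℂ, IsEigenvalue ℓ σ q ρ z ↔ ∃ n, z = (eig n : ℂ)) ∧
      0 < eig 0 ∧ StrictMono eig ∧ Filter.Tendsto eig Filter.atTop Filter.atTop ∧
      (∀ n, Module.finrank ℂ (eigenSpace hℓ σ q ρ (eig n : ℂ)) = 1 ∧
        Module.finrank ℂ (genEigenSpace hℓ σ q ρ (eig n : ℂ)) = 1) ∧
      (∀ n, ∀ Φ : ℝ → ℂ, IsEigenfunction ℓ σ q ρ (eig n : ℂ) Φ →
        iteratedDerivWithin 2 Φ (Icc 0 ℓ) ℓ ≠ 0) := by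
  obtain ⟨s, k, p, R⟩ := exists_isRepresentative hℓ hρH hσH hqH hρ₀ hσ₀ hρ hσ hq
  have B := R.toBeamCoeffs
  obtain ⟨eig, hmono, hrange, htend⟩ :=
    exists_strictMono_range_eq B.infinite_beamEigenvalues B.finite_beamEigenvalues_inter_Iic
  have hmem (n : ℕ) : eig n ∈ beamEigenvalues ℓ s k p := hrange ▸ mem_range_self n
  have hpos (n : ℕ) : 0 < eig n := B.pos_of_mem_beamEigenvalues (hmem n)
  refine ⟨eig, fun z => ?_, hpos 0, hmono, htend, fun n => ?_,
    fun n Φ hΦ => hΦ.iteratedDerivWithin_two_ne_zero R (hpos n).le⟩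
  · rw [isEigenvalue_iff R, ← hrange, exists_range_iff]
  · rw [genEigenSpace_eq_eigenSpace R]
    exact ⟨finrank_eigenSpace R (hmem n), finrank_eigenSpace R (hmem n)⟩

/-- The eigenvalues `λ₁ < λ₂ < …` are `eig 0 < eig 1 < …`. -/
theorem theorem3p1 (ℓ : ℝ) (hℓ : 0 < ℓ) (σ q ρ : ℝ → ℝ)
    (hρH : ClampedBeam.MemH ℓ 2 ρ) (hσH : ClampedBeam.MemH ℓ 2 σ) (hqH : ClampedBeam.MemH ℓ 1 q)
    (ρ₀ σ₀ : ℝ) (hρ₀ : 0 < ρ₀) (hσ₀ : 0 < σ₀)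
    (hρ : ∀ x ∈ Set.Icc 0 ℓ, ρ₀ ≤ ρ x) (hσ : ∀ x ∈ Set.Icc 0 ℓ, σ₀ ≤ σ x)
    (hq : ∀ x ∈ Set.Icc 0 ℓ, 0 ≤ q x) :
    ∃ eig : ℕ → ℝ,
      (∀ z : ℂ, ClampedBeam.IsEigenvalue ℓ σ q ρ z ↔ ∃ n, z = (eig n : ℂ)) ∧
      0 < eig 0 ∧ StrictMono eig ∧ Filter.Tendsto eig Filter.atTop Filter.atTop ∧
      (∀ n, Module.finrank ℂ (ClampedBeam.eigenSpace hℓ σ q ρ (eig n : ℂ)) = 1 ∧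
        Module.finrank ℂ (ClampedBeam.genEigenSpace hℓ σ q ρ (eig n : ℂ)) = 1) ∧
      (∀ n, ∀ Φ : ℝ → ℂ, ClampedBeam.IsEigenfunction ℓ σ q ρ (eig n : ℂ) Φ →
        iteratedDerivWithin 2 Φ (Set.Icc 0 ℓ) ℓ ≠ 0) :=
  have ⟨ρ', hρ', _⟩ := hρH
  theorem3p1_general ℓ hℓ σ q ρ ⟨ρ', hρ', hρ'.memLp_deriv⟩ hσH hqH ρ₀ σ₀ hρ₀ hσ₀ hρ hσ hq
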